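/- Let $q\in\mathbb{C}$ with $0<|q|<1$ and fix a square root $q^{1/2}$ of $q$. For $x\in\mathbb{C}$ write $x=\tfrac12(z+1/z)$ with $z=x+\sqrt{x^2-1}$, where the branch is chosen so that $\sqrt{x^2-1}\sim x$ as $x\to\infty$ (and $z=x+i\sqrt{1-x^2}$ for $x\in[-1,1]$), and put $$\hat x=\tfrac12\big(q^{1/2}z+q^{-1/2}z^{-1}\big),\qquad \check x=\tfrac12\big(q^{-1/2}z+q^{1/2}z^{-1}\big).$$ For a meromorphic function $f$ on $\mathbb{C}$, the Askey–Wilson operator is $$(\mathcal{D}_qf)(x)=\frac{f(\hat x)-f(\check x)}{\hat x-\check x}\quad(x\ne\pm1),\qquad (\mathcal{D}_qf)(\pm1)=f'\big(\pm\tfrac12(q^{1/2}+q^{-1/2})\big),$$ which is again a meromorphic function; $\ker\mathcal{D}_q$ is the set of meromorphic $f$ with $\mathcal{D}_qf\equiv0$. For $a\in\mathbb{C}$, the AW-counting function $n_{\mathrm{AW}}(r,f=a)$ is the sum, over all points $x$ with $|x|<r$ at which $f(x)=a$, of the integers $h-\min\{h,k'\}$, where $h$ is the multiplicity of $f=a$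 at $x$ and $k'$ is the multiplicity of $\hat x$ as a zero of $\mathcal{D}_qf$ ($k'=0$ if $\hat x$ is not a zero). For $a=\infty$ it is the same sum over the zeros $x$ of $1/f$ in $|x|<r$, with $h$ the multiplicity of $1/f=0$ at $x$ and $k'$ the multiplicity of $\hat x$ as a zero of $\mathcal{D}_q(1/f)$. A value $a\in\mathbb{C}\cup\{\infty\}$ is an AW-Picard value of $f$ if $n_{\mathrm{AW}}(r,f=a)=O(1)$ as $r\to\infty$. The function $f$ has finite logarithmic order if $$\limsup_{r\to\infty}\frac{\log T(r,f)}{\log\log r}<+\infty,$$ where $T(r,f)$ is the Nevanlinna characteristic. **Theorem.** Let $f$ be a meromorphic function on $\mathbb{C}$ of finite logarithmic order that has three distinct AW-Picard values in $\mathbb{C}\cup\{\infty\}$. Then $f$ is a rational function or $f\in\ker\mathcal{D}_q$. -/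

import Mathlib

open Filter Topology

noncomputable section

namespace AskeyWilson

/-- The branch `z = x + √(x² - 1)` of the solution of `x = (z + 1/z)/2` with `√(x² - 1) ~ x` as
`x → ∞`; on `[-1, 1]` it takes the boundary value from above, `z = x + i √(1 - x²)`. -/
def zBranch (x : ℂ) : ℂ := x + (x - 1) ^ (1 / 2 : ℂ) * (x + 1) ^ (1 / 2 : ℂ)

/-- The point `x̂ = (q^{1/2} z + q^{-1/2} z⁻¹)/2`, where `s` is the chosen square root of `q`. -/
def hatPt (s x : ℂ) : ℂ := (s * zBranch x + s⁻¹ * (zBranch x)⁻¹) / 2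

/-- The point `x̌ = (q^{-1/2} z + q^{1/2} z⁻¹)/2`, where `s` is the chosen square root of `q`. -/
def checkPt (s x : ℂ) : ℂ := (s⁻¹ * zBranch x + s * (zBranch x)⁻¹) / 2

/-- The Askey-Wilson divided difference operator `D_q`, where `s` is the chosen square root of `q`.
At `x = ±1` the quotient is replaced by its limiting value. As usual for meromorphic functions, the
values on a discrete set (at poles) carry no information. -/
def awOp (s : ℂ) (f : ℂ → ℂ) (x : ℂ) : ℂ :=
  if x = 1 then deriv f ((s + s⁻¹) / 2)
  else if x = -1 then deriv f (-((s + s⁻¹) / 2))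
  else (f (hatPt s x) - f (checkPt s x)) / (hatPt s x - checkPt s x)

/-- The multiplicity of `x` as a zero of the meromorphic function `g`: `0` if `x` is not a zero
(in particular at a pole), `⊤` if `g` vanishes identically near `x`. -/
def zeroMult (g : ℂ → ℂ) (x : ℂ) : ℕ∞ := (meromorphicOrderAt g x).map Int.toNat

/-- The number `h - min h k'`, where `h` is the multiplicity of `x` as a zero of `g` and `k'` is the
multiplicity of `x̂` as a zero of `D_q u`. -/
def awMult (s : ℂ) (g u : ℂ → ℂ) (x : ℂ) : ℕ∞ :=
  zeroMult g x - min (zeroMult g x) (zeroMult (awOp s u) (hatPt s x))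

/-- The Askey-Wilson counting function of the value `a`, finite or infinite: the sum of
the numbers `h - min h k'` over the points of the disc `|x| < r`. For finite `a`, `h` is the
multiplicity of `f = a` at `x` and `k'` that of `D_q f = 0` at `x̂`; for `a = ∞`, `h` is the
multiplicity of `1/f = 0` at `x` and `k'` that of `D_q (1/f) = 0` at `x̂`. -/
def awCount (s : ℂ) (f : ℂ → ℂ) (a : WithTop ℂ) (r : ℝ) : ℕ∞ :=
  match a with
  | (a : ℂ) => ∑ᶠ x ∈ Metric.ball (0 : ℂ) r, awMult s (fun y => f y - a) f x
  | ⊤ => ∑ᶠ x ∈ Metric.ball (0 : ℂ) r, awMult s f⁻¹ f⁻¹ x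

/-- `a` is an Askey-Wilson Picard value of `f` if the counting function of `a` is `O(1)` as
`r → ∞`. -/
def IsAWPicardValue (s : ℂ) (f : ℂ → ℂ) (a : WithTop ℂ) : Prop :=
  ∃ C : ℕ, ∀ᶠ r : ℝ in atTop, awCount s f a r ≤ C

/-- The logarithmic order `limsup log T(r, f) / log log r`, where `T` is the Nevanlinna
characteristic. -/
def logarithmicOrder (f : ℂ → ℂ) : EReal :=
  limsup (fun r : ℝ =>
    ((Real.log (ValueDistribution.characteristic f ⊤ r) / Real.log (Real.log r) : ℝ) : EReal)) atTop

/-- A meromorphic function is rational if it is a quotient of two polynomials off a discrete set. -/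
def IsRational (f : ℂ → ℂ) : Prop :=
  ∃ P Q : Polynomial ℂ, Q ≠ 0 ∧ f =ᶠ[codiscrete ℂ] fun x => P.eval x / Q.eval x

/-- A meromorphic function `f` lies in the kernel of `D_q` if `D_q f` vanishes identically as a
meromorphic function, that is off a discrete set. -/
def InKerAW (s : ℂ) (f : ℂ → ℂ) : Prop := awOp s f =ᶠ[codiscrete ℂ] 0

end AskeyWilson

end

namespace AskeyWilson

open Real Metric MeromorphicOn

/-! ### Circle averages -/

/-! The proof is a second main theorem of Nevanlinna theory with `D_q f` in the role of the
derivative, followed by a bootstrap that uses the finite logarithmic order. Write `m`, `N`, `T` for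
the proximity, counting and characteristic functions, and assume that `f` is not constant and `D_q
f` does not vanish identically.

Counting half. Far from the origin, an AW-Picard value taken at `x` with multiplicity `h` forces a
zero of multiplicity at least `h` at `x̂`, of `D_q f` for a finite value and of `D_q (1/f) = -D_q f
/ (f(x̂) f(x̌))` for `∞`. Summed over the values and transported along `x ↦ x̂`, `x ↦ x̌`, this
bounds `∑ N(r, v)` by the counting function of the divisor of `D_q f` plus two copies of `N(·, ∞)`
and `O(log r)` (`exists_eventually_sum_logCounting_le`).

Proximity half. If `a` is the finite value nearest to `f(x)`, then `log |D_q f(x)|` is at most `log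
|f(x) - a|` plus logarithmic increments of `f - a` from `x` to `x̂` and `x̌`, up to a constant.
Averaging gives a bound for the mean of `log |D_q f|` plus `∑ m(r, v)` by `2 m(r, f)` plus mean
increments (`exists_eventually_circleAverage_log_norm_awOp_le`).

The increments are estimated by a logarithmic difference lemma
(`circleAverage_abs_log_increment_le`, `exists_eventually_meanIncrement_le`): divide out the zeros
and poles in the disc of radius `r ^ 2`. The zero-free factor has a harmonic log-modulus, which the
Poisson formula controls. Each linear factor costs `O(1)` in the mean, because `x̂` and `x̌` are the
roots of a quadratic that is monic in `x` as well. The number of factors is `O((1 + T(r ^ 4)) / log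
r)`.

By Jensen's formula the `D_q f` terms of the two halves cancel. Three values then give `3 T ≤ 2 T +
error`, that is, `T(r) ≤ C (log r + T(r ^ 4) / log r)` (`exists_eventually_characteristic_le`). If
`T` is bounded by a power of `log r`, each application lowers the exponent by one, down to `T =
O(log r)`, and this growth forces `f` to be rational (`isRational_of_characteristic_le`). -/

theorem circleAverage_mono_codiscreteWithin {f g : ℂ → ℝ} {c : ℂ} {R : ℝ} (hR : R ≠ 0)
    (hf : CircleIntegrable f c R) (hg : CircleIntegrable g c R)
    (h : f ≤ᶠ[codiscreteWithin (sphere c |R|)] g) :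
    circleAverage f c R ≤ circleAverage g c R := by
  -- Circle averages ignore discrete sets, so `f` may be replaced by `min f g`, which is below `g`
  -- everywhere.
  have h1 : f =ᶠ[codiscreteWithin (sphere c |R|)] fun x => min (f x) (g x) := by
    filter_upwards [h] with x hx
    exact (min_eq_left hx).symm
  rw [circleAverage_congr_codiscreteWithin h1 hR]
  exact circleAverage_mono (hf.congr_codiscreteWithin h1) hg (fun x _ => min_le_right _ _)

theorem abs_log_eq_posLog_add_posLog_inv (t : ℝ) : |log t| = log⁺ t + log⁺ t⁻¹ := by
  have h1 := posLog_sub_posLog_inv (x := t)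
  have h2 := half_mul_log_add_log_abs (x := t)
  linarith

theorem circleAverage_abs_log_norm_eq {f : ℂ → ℂ} (hf : Meromorphic f) (R : ℝ) :
    circleAverage (fun z => |log ‖f z‖|) 0 R
      = ValueDistribution.proximity f ⊤ R + ValueDistribution.proximity f⁻¹ ⊤ R := by
  rw [ValueDistribution.proximity_top, ValueDistribution.proximity_top,
    ← circleAverage_add]
  · congr 1
    ext z
    simp [abs_log_eq_posLog_add_posLog_inv]
  · exact hf.meromorphicOn.circleIntegrable_posLog_norm
  · exact hf.inv.meromorphicOn.circleIntegrable_posLog_norm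

theorem circleIntegrable_abs_log_norm_sub (u : ℂ) (R : ℝ) :
    CircleIntegrable (fun z => |log ‖z - u‖|) 0 R :=
  (circleIntegrable_log_norm_sub_const R).abs

/-- Since `|log t| = 2 log⁺ t - log t`, it suffices that `log⁺ ‖z - u‖ ≤ log (2R)` on the circle and
that the mean of `log ‖z - u‖` is `log R ≥ 0` for `u` in the disc. -/
theorem circleAverage_abs_log_norm_sub_le {R : ℝ} (hR : 1 ≤ R) {u : ℂ} (hu : ‖u‖ ≤ R) :
    circleAverage (fun z => |log ‖z - u‖|) 0 R ≤ 2 * log (2 * R) := by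
  have hR0 : 0 < R := by linarith
  have key : circleAverage (fun z => |log ‖z - u‖|) 0 R ≤
      circleAverage (fun z => 2 * log (2 * R) - log ‖z - u‖) 0 R := by
    apply circleAverage_mono (circleIntegrable_abs_log_norm_sub u R)
      ((circleIntegrable_const _ _ _).sub (circleIntegrable_log_norm_sub_const R))
    intro z hz
    rw [mem_sphere_zero_iff_norm, abs_of_pos hR0] at hz
    have h1 : ‖z - u‖ ≤ 2 * R := by
      calc ‖z - u‖ ≤ ‖z‖ + ‖u‖ := norm_sub_le _ _
        _ ≤ 2 * R := by linarith
    have h2 := half_mul_log_add_log_abs (x := ‖z - u‖)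
    have h3 := posLog_le_posLog (norm_nonneg _) h1
    rw [posLog_eq_log (x := 2 * R) (by rw [abs_of_pos] <;> linarith)] at h3
    simp only [Pi.sub_apply]
    linarith
  have h4 := circleAverage_fun_sub (circleIntegrable_const (2 * log (2 * R)) (0 : ℂ) R)
    (circleIntegrable_log_norm_sub_const (a := u) (c := 0) R)
  rw [circleAverage_const, circleAverage_log_norm_sub_const_of_mem_closedBall
    (by simpa [abs_of_pos hR0] using hu)] at h4
  have h5 : 0 ≤ log R := log_nonneg hR
  linarith

/-! ### Increments of harmonic functions -/

theorem abs_re_herglotzRieszKernel_sub_le {R : ℝ} (hR : 0 < R) {x y ζ : ℂ}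
    (hx : ‖x‖ ≤ R / 2) (hy : ‖y‖ ≤ R / 2) (hζ : ‖ζ‖ = R) :
    |(herglotzRieszKernel 0 x ζ).re - (herglotzRieszKernel 0 y ζ).re| ≤ 8 * ‖x - y‖ / R := by
  have h1 : ∀ w : ℂ, ‖w‖ ≤ R / 2 → R / 2 ≤ ‖ζ - w‖ := by
    intro w hw
    have := norm_sub_norm_le ζ w
    linarith
  have hx1 := h1 x hx
  have hy1 := h1 y hy
  have hx0 : ζ - x ≠ 0 := by rw [← norm_pos_iff]; linarith
  have hy0 : ζ - y ≠ 0 := by rw [← norm_pos_iff]; linarith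
  have h2 : herglotzRieszKernel 0 x ζ - herglotzRieszKernel 0 y ζ
      = 2 * ζ * (x - y) / ((ζ - x) * (ζ - y)) := by
    simp only [herglotzRieszKernel_def, sub_zero]
    field_simp
    ring
  rw [← Complex.sub_re, h2]
  refine (Complex.abs_re_le_norm _).trans ?_
  rw [norm_div, norm_mul, norm_mul, norm_mul, hζ, div_le_div_iff₀ (by positivity) hR]
  have h3 : R / 2 * (R / 2) ≤ ‖ζ - x‖ * ‖ζ - y‖ := by gcongr
  have h4 := mul_le_mul_of_nonneg_left h3 (norm_nonneg (x - y))
  simp only [Complex.norm_ofNat]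
  nlinarith

theorem continuousOn_re_herglotzRieszKernel {R : ℝ} {x : ℂ} (hx : ‖x‖ < |R|) :
    ContinuousOn (Complex.re ∘ herglotzRieszKernel 0 x) (sphere 0 |R|) := by
  rw [herglotzRieszKernel_fun_def]
  have : ∀ ζ ∈ sphere (0 : ℂ) |R|, ζ - x ≠ 0 := by
    intro ζ hζ h
    rw [mem_sphere_zero_iff_norm] at hζ
    rw [sub_eq_zero] at h
    rw [h] at hζ
    linarith
  simp only [sub_zero, Function.comp_def]
  fun_prop (disch := assumption)

/-- Both values are Poisson integrals over the circle of radius `R`, and on the half disc the two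
kernels differ by at most `8 ‖x - y‖ / R`. -/
theorem abs_sub_le_of_harmonicOnNhd {u : ℂ → ℝ} {R : ℝ} (hR : 0 < R)
    (hu : InnerProductSpace.HarmonicOnNhd u (closedBall 0 R)) {x y : ℂ}
    (hx : ‖x‖ ≤ R / 2) (hy : ‖y‖ ≤ R / 2) :
    |u x - u y| ≤ 8 * ‖x - y‖ / R * circleAverage (fun ζ => |u ζ|) 0 R := by
  have hxb : x ∈ ball (0 : ℂ) R := by rw [mem_ball_zero_iff]; linarith
  have hyb : y ∈ ball (0 : ℂ) R := by rw [mem_ball_zero_iff]; linarith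
  have hcu : ContinuousOn u (sphere 0 |R|) := by
    intro z hz
    have := hu z (by rw [abs_of_pos hR] at hz; exact sphere_subset_closedBall hz)
    exact this.1.continuousAt.continuousWithinAt
  have hkx := continuousOn_re_herglotzRieszKernel (R := R) (x := x)
    (by rw [abs_of_pos hR]; linarith)
  have hky := continuousOn_re_herglotzRieszKernel (R := R) (x := y)
    (by rw [abs_of_pos hR]; linarith)
  rw [← hu.circleAverage_re_herglotzRieszKernel_smul hxb,
    ← hu.circleAverage_re_herglotzRieszKernel_smul hyb,
    ← circleAverage_sub ((hkx.smul hcu).circleIntegrable') ((hky.smul hcu).circleIntegrable')]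
  refine abs_circleAverage_le_circleAverage_abs.trans ?_
  rw [← smul_eq_mul, ← circleAverage_fun_smul]
  apply circleAverage_mono
  · exact (((hkx.smul hcu).sub (hky.smul hcu)).circleIntegrable').abs
  · exact (ContinuousOn.circleIntegrable' hcu.abs).const_mul _
  · intro ζ hζ
    rw [mem_sphere_zero_iff_norm, abs_of_pos hR] at hζ
    simp only [Pi.abs_apply, Pi.sub_apply, smul_eq_mul, Pi.mul_apply, Function.comp_apply]
    rw [← sub_mul, abs_mul]
    gcongr
    exact abs_re_herglotzRieszKernel_sub_le hR hx hy hζ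

/-! ### Splitting off the zeros and poles in a disc -/

theorem exists_eq_prod_mul_and_log_norm_eq {f : ℂ → ℂ} {U : Set ℂ} (hf : MeromorphicOn f U)
    (h0 : ∀ z ∈ U, meromorphicOrderAt f z ≠ ⊤) (hfin : (divisor f U).support.Finite) :
    ∃ g : ℂ → ℂ, AnalyticOnNhd ℂ g U ∧ (∀ z ∈ U, g z ≠ 0) ∧
      f =ᶠ[codiscreteWithin U] (fun z => (∏ u ∈ hfin.toFinset, (z - u) ^ divisor f U u) * g z) ∧
      (fun z => log ‖f z‖) =ᶠ[codiscreteWithin U]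
        fun z => ∑ u ∈ hfin.toFinset, (divisor f U u : ℝ) * log ‖z - u‖ + log ‖g z‖ := by
  obtain ⟨g, hg, hg0, hfg⟩ := hf.extract_zeros_poles (fun u => h0 u u.2) hfin
  refine ⟨g, hg, fun z hz => hg0 ⟨z, hz⟩, ?_, ?_⟩
  · refine hfg.trans (Eventually.of_forall fun z => ?_)
    have hsub : (fun u => ((· - u) ^ divisor f U u : ℂ → ℂ)).mulSupport ⊆ hfin.toFinset := by
      rw [Function.FactorizedRational.mulSupport, Set.Finite.coe_toFinset]
    rw [finprod_eq_prod_of_mulSupport_subset _ hsub]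
    simp
  · refine (extract_zeros_poles_log hg0 hfg).trans (Eventually.of_forall fun z => ?_)
    have hsub : (fun u => (fun z : ℂ => (divisor f U u : ℝ) * log ‖z - u‖)).support
        ⊆ hfin.toFinset := by
      intro u hu
      simp only [Set.Finite.coe_toFinset, Function.mem_support] at hu ⊢
      intro h
      apply hu
      ext z
      simp [h]
    simp only [Pi.add_apply]
    rw [finsum_eq_sum_of_support_subset _ hsub, Finset.sum_apply]

/-- Solve the factorization for `log ‖g‖` and apply the triangle inequality; each linear factor
contributes at most `2 log (2R)` in the mean. -/
theorem circleAverage_abs_log_norm_le_of_factor {f g : ℂ → ℂ} {R : ℝ} (hR : 1 ≤ R)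
    (hf : Meromorphic f) {F : Finset ℂ} {D : ℂ → ℤ} (hF : ∀ u ∈ F, ‖u‖ ≤ R)
    (hg : AnalyticOnNhd ℂ g (sphere 0 |R|))
    (hfg : (fun z => log ‖f z‖) =ᶠ[codiscreteWithin (sphere 0 |R|)]
        fun z => ∑ u ∈ F, (D u : ℝ) * log ‖z - u‖ + log ‖g z‖) :
    circleAverage (fun z => |log ‖g z‖|) 0 R ≤ circleAverage (fun z => |log ‖f z‖|) 0 R +
      (∑ u ∈ F, |(D u : ℝ)|) * (2 * log (2 * R)) := by
  have hR0 : R ≠ 0 := by positivity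
  have i1 : CircleIntegrable (fun z => |log ‖f z‖|) 0 R :=
    hf.meromorphicOn.circleIntegrable_log_norm.abs
  have i2 : ∀ u ∈ F, CircleIntegrable (fun z => |(D u : ℝ)| * |log ‖z - u‖|) 0 R :=
    fun u _ => (circleIntegrable_abs_log_norm_sub u R).const_mul _
  have i3 : CircleIntegrable (fun z => ∑ u ∈ F, |(D u : ℝ)| * |log ‖z - u‖|) 0 R :=
    CircleIntegrable.fun_sum F i2
  have key : circleAverage (fun z => |log ‖g z‖|) 0 R ≤
      circleAverage (fun z => |log ‖f z‖| + ∑ u ∈ F, |(D u : ℝ)| * |log ‖z - u‖|) 0 R := by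
    apply circleAverage_mono_codiscreteWithin hR0
      hg.meromorphicOn.circleIntegrable_log_norm.abs (i1.add i3)
    filter_upwards [hfg] with z hz
    have h1 : log ‖g z‖ = log ‖f z‖ - ∑ u ∈ F, (D u : ℝ) * log ‖z - u‖ := by rw [hz]; ring
    simp only [Pi.abs_apply, Pi.add_apply]
    rw [h1]
    refine (abs_sub _ _).trans ?_
    gcongr
    refine (Finset.abs_sum_le_sum_abs _ _).trans (le_of_eq ?_)
    simp [abs_mul]
  refine key.trans ?_
  rw [circleAverage_fun_add i1 i3, circleAverage_fun_sum i2, Finset.sum_mul]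
  gcongr with u hu
  have := circleAverage_fun_smul (a := |(D u : ℝ)|) (f := fun z => |log ‖z - u‖|) (c := 0) (R := R)
  simp only [smul_eq_mul] at this
  rw [this]
  gcongr
  exact circleAverage_abs_log_norm_sub_le hR (hF u hu)

end AskeyWilson

namespace AskeyWilson

open Real Metric MeromorphicOn

/-! ### Logarithmic increments of a meromorphic function along a self-map of a circle -/

/-- The number of zeros and poles in the closed disc of radius `R`, with multiplicity. -/
noncomputable def zeroPoleCount (f : ℂ → ℂ) (R : ℝ) : ℝ :=
  ∑ u ∈ ((divisor f (closedBall 0 R)).finiteSupport (isCompact_closedBall 0 R)).toFinset,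
    |(divisor f (closedBall 0 R) u : ℝ)|

theorem meromorphicOn_comp_sphere {f y : ℂ → ℂ} (hf : Meromorphic f) {r : ℝ}
    (hy : AnalyticOnNhd ℂ y (sphere 0 |r|)) : MeromorphicOn (fun x => f (y x)) (sphere 0 |r|) :=
  fun x hx => (hf (y x)).comp_analyticAt (hy x hx)

theorem circleIntegrable_abs_log_increment {f y : ℂ → ℂ} (hf : Meromorphic f) {r : ℝ}
    (hy : AnalyticOnNhd ℂ y (sphere 0 |r|)) :
    CircleIntegrable (fun x => |log ‖f (y x)‖ - log ‖f x‖|) 0 r :=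
  ((meromorphicOn_comp_sphere hf hy).circleIntegrable_log_norm.sub
    hf.meromorphicOn.circleIntegrable_log_norm).abs

/-- This is the logarithmic difference lemma with the linear factors isolated: the hypothesis `hA`
prices one linear factor at `A`, and the remaining zero-free factor `g` is handled by the increment
bound for the harmonic function `log ‖g‖`. -/
theorem circleAverage_abs_log_increment_le {f y : ℂ → ℂ} (hf : Meromorphic f)
    (h0 : ∀ z, meromorphicOrderAt f z ≠ ⊤) {r R K A : ℝ} (hr : 0 < r) (hR : 1 ≤ R) (hK : 1 ≤ K)
    (hKR : K * r ≤ R / 2) (hy : AnalyticOnNhd ℂ y (sphere 0 |r|))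
    (hyc : ∀ x ∈ sphere (0 : ℂ) |r|, ¬ EventuallyConst y (𝓝 x))
    (hyK : ∀ x ∈ sphere (0 : ℂ) |r|, ‖y x‖ ≤ K * r)
    (hA : ∀ u, circleAverage (fun x => |log ‖y x - u‖ - log ‖x - u‖|) 0 r ≤ A) :
    circleAverage (fun x => |log ‖f (y x)‖ - log ‖f x‖|) 0 r ≤ zeroPoleCount f R * A +
      8 * (2 * K * r) / R *
        (circleAverage (fun z => |log ‖f z‖|) 0 R + zeroPoleCount f R * (2 * log (2 * R))) := by
  have hR0 : 0 < R := by linarith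
  have hfin := (divisor f (closedBall 0 R)).finiteSupport (isCompact_closedBall 0 R)
  obtain ⟨g, hg, hg0, -, hfg⟩ := exists_eq_prod_mul_and_log_norm_eq (U := closedBall 0 R)
    hf.meromorphicOn (fun z _ => h0 z) hfin
  set F := hfin.toFinset with hF
  obtain ⟨D, hD⟩ : ∃ D : ℂ → ℤ, D = fun u => divisor f (closedBall 0 R) u := ⟨_, rfl⟩
  have hn : zeroPoleCount f R = ∑ u ∈ F, |(D u : ℝ)| := by rw [hD]; rfl
  replace hfg : (fun z => log ‖f z‖) =ᶠ[codiscreteWithin (closedBall 0 R)]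
      fun z => ∑ u ∈ F, (D u : ℝ) * log ‖z - u‖ + log ‖g z‖ := by rw [hD]; exact hfg
  have hFR : ∀ u ∈ F, ‖u‖ ≤ R := by
    intro u hu
    have : u ∈ (divisor f (closedBall 0 R)).support := by simpa [hF] using hu
    have := (divisor f (closedBall 0 R)).supportWithinDomain this
    simpa using this
  have hrR : r ≤ R / 2 := by nlinarith
  have hu : InnerProductSpace.HarmonicOnNhd (fun z => log ‖g z‖) (closedBall 0 R) :=
    fun z hz => (hg z hz).harmonicAt_log_norm (hg0 z hz)
  have hgavg := circleAverage_abs_log_norm_le_of_factor hR hf (D := D) hFR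
    (hg.mono (by rw [abs_of_pos hR0]; exact sphere_subset_closedBall))
    (hfg.filter_mono (codiscreteWithin_mono
      (by rw [abs_of_pos hR0]; exact sphere_subset_closedBall)))
  set B := circleAverage (fun z => |log ‖f z‖|) 0 R + zeroPoleCount f R * (2 * log (2 * R)) with hB
  have hnorm : ∀ x ∈ sphere (0 : ℂ) |r|, ‖x‖ = r := by
    intro x hx
    rwa [mem_sphere_zero_iff_norm, abs_of_pos hr] at hx
  have i2 : ∀ u ∈ F, CircleIntegrable
      (fun x => |(D u : ℝ)| * |log ‖y x - u‖ - log ‖x - u‖|) 0 r := fun u _ =>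
    (circleIntegrable_abs_log_increment (f := fun z => z - u) (fun z => by fun_prop) hy).const_mul _
  have i3 : CircleIntegrable
      (fun x => ∑ u ∈ F, |(D u : ℝ)| * |log ‖y x - u‖ - log ‖x - u‖|) 0 r :=
    CircleIntegrable.fun_sum F i2
  have i4 : CircleIntegrable (fun _ => 8 * (2 * K * r) / R * B) (0 : ℂ) r :=
    circleIntegrable_const _ _ _
  have h1 : ∀ᶠ x in codiscreteWithin (sphere (0 : ℂ) |r|),
      log ‖f x‖ = ∑ u ∈ F, (D u : ℝ) * log ‖x - u‖ + log ‖g x‖ := by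
    apply hfg.filter_mono
    apply codiscreteWithin_mono
    intro x hx
    rw [mem_closedBall_zero_iff, hnorm x hx]
    linarith
  have h2 : ∀ᶠ x in codiscreteWithin (sphere (0 : ℂ) |r|),
      log ‖f (y x)‖ = ∑ u ∈ F, (D u : ℝ) * log ‖y x - u‖ + log ‖g (y x)‖ := by
    -- The factorization holds only off a discrete set; its preimage under `y` stays discrete
    -- because `y` is nowhere locally constant.
    refine hy.preimage_mem_codiscreteWithin hyc (hfg.filter_mono (codiscreteWithin_mono ?_))
    rintro _ ⟨x, hx, rfl⟩
    rw [mem_closedBall_zero_iff]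
    linarith [hyK x hx]
  have key : circleAverage (fun x => |log ‖f (y x)‖ - log ‖f x‖|) 0 r ≤
      circleAverage (fun x => ∑ u ∈ F, |(D u : ℝ)| * |log ‖y x - u‖ - log ‖x - u‖| +
        8 * (2 * K * r) / R * B) 0 r := by
    apply circleAverage_mono_codiscreteWithin hr.ne'
      (circleIntegrable_abs_log_increment hf hy) (i3.add i4)
    filter_upwards [h1, h2, self_mem_codiscreteWithin _] with x hx1 hx2 hxs
    simp only [Pi.add_apply]
    have e1 : log ‖f (y x)‖ - log ‖f x‖ =
        ∑ u ∈ F, (D u : ℝ) * (log ‖y x - u‖ - log ‖x - u‖) + (log ‖g (y x)‖ - log ‖g x‖) := by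
      rw [hx1, hx2]
      simp only [mul_sub, Finset.sum_sub_distrib]
      ring
    rw [e1]
    refine (abs_add_le _ _).trans (add_le_add ?_ ?_)
    · refine (Finset.abs_sum_le_sum_abs _ _).trans (le_of_eq ?_)
      simp [abs_mul]
    · have hxr := hnorm x hxs
      refine (abs_sub_le_of_harmonicOnNhd hR0 hu (x := y x) (y := x)
        ((hyK x hxs).trans hKR) (by linarith)).trans ?_
      have h3 : ‖y x - x‖ ≤ 2 * K * r := by
        calc ‖y x - x‖ ≤ ‖y x‖ + ‖x‖ := norm_sub_le _ _
          _ ≤ K * r + r := by rw [hxr]; linarith [hyK x hxs]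
          _ ≤ 2 * K * r := by nlinarith
      have h4 : 0 ≤ circleAverage (fun z => |log ‖g z‖|) 0 R :=
        circleAverage_nonneg_of_nonneg (fun _ _ => abs_nonneg _)
      gcongr
      rw [hB, hn]
      exact hgavg
  refine key.trans ?_
  rw [circleAverage_fun_add i3 i4, circleAverage_const, circleAverage_fun_sum i2, hn,
    Finset.sum_mul]
  gcongr with u hu
  have := circleAverage_fun_smul (a := |(D u : ℝ)|)
    (f := fun x => |log ‖y x - u‖ - log ‖x - u‖|) (c := 0) (R := r)
  simp only [smul_eq_mul] at this
  rw [this]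
  exact mul_le_mul_of_nonneg_left (hA u) (abs_nonneg _)

/-- If `y` and `y'` are the roots of a quadratic polynomial in `x` which is monic and of degree two
in `x`, then the logarithmic distances of `y x` and `x` to a point differ by `O(1)` in the mean. -/
theorem circleAverage_abs_log_norm_sub_increment_le {y y' : ℂ → ℂ} {α β : ℂ} {r K : ℝ} (hr : 0 < r)
    (hK : 1 ≤ K) (hβ : ‖β‖ ≤ r ^ 2) (hy : AnalyticOnNhd ℂ y (sphere 0 |r|))
    (hyK : ∀ x ∈ sphere (0 : ℂ) |r|, ‖y x‖ ≤ K * r)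
    (hyK' : ∀ x ∈ sphere (0 : ℂ) |r|, ‖y' x‖ ≤ K * r)
    (hadd : ∀ x, y x + y' x = 2 * α * x) (hmul : ∀ x, y x * y' x = x ^ 2 + β) (u : ℂ) :
    circleAverage (fun x => |log ‖y x - u‖ - log ‖x - u‖|) 0 r ≤ 4 * log 2 + 3 * log⁺ K := by
  -- `(y - u)(y' - u) = x² - 2αux + u² + β` is monic in `x`; `d` is the root of its reduced
  -- discriminant and `c₁`, `c₂` are its zeros.
  obtain ⟨d, hd⟩ := IsAlgClosed.exists_pow_nat_eq (α ^ 2 * u ^ 2 - u ^ 2 - β) (n := 2) (by norm_num)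
  set c₁ := α * u + d with hc₁
  set c₂ := α * u - d with hc₂
  have hcc : c₁ * c₂ = u ^ 2 + β := by
    rw [hc₁, hc₂]; linear_combination -hd
  have hp : ∀ x, (y x - u) * (y' x - u) = (x - c₁) * (x - c₂) := by
    intro x
    linear_combination hmul x - u * hadd x - hcc + x * (hc₁ + hc₂)
  set M := ‖u‖ + K * r with hM
  have hM0 : 0 < M := by positivity
  have hnorm : ∀ x ∈ sphere (0 : ℂ) |r|, ‖x‖ = r := by
    intro x hx
    rwa [mem_sphere_zero_iff_norm, abs_of_pos hr] at hx
  have i (a : ℂ) := circleIntegrable_log_norm_sub_const (a := a) (c := 0) r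
  have i0 : CircleIntegrable (fun _ => 3 * log M) (0 : ℂ) r := circleIntegrable_const _ _ _
  have key : circleAverage (fun x => |log ‖y x - u‖ - log ‖x - u‖|) 0 r ≤
      circleAverage (fun x => 3 * log M - log ‖x - c₁‖ - log ‖x - c₂‖ - log ‖x - u‖) 0 r := by
    apply circleAverage_mono_codiscreteWithin hr.ne'
      (circleIntegrable_abs_log_increment (f := fun z => z - u) (fun z => by fun_prop) hy)
      (((i0.sub (i c₁)).sub (i c₂)).sub (i u))
    have hfin : ({c₁, c₂, u} : Set ℂ).Finite := by simp
    filter_upwards [compl_finite_mem_codiscreteWithin hfin, self_mem_codiscreteWithin _]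
      with x hx hxs
    simp only [Set.mem_compl_iff, Set.mem_insert_iff, Set.mem_singleton_iff, not_or] at hx
    obtain ⟨hx1, hx2, hx3⟩ := hx
    have hpx := hp x
    have hne : (y x - u) * (y' x - u) ≠ 0 := by
      rw [hpx]
      exact mul_ne_zero (sub_ne_zero.2 hx1) (sub_ne_zero.2 hx2)
    have hy0 : 0 < ‖y x - u‖ := norm_pos_iff.2 (left_ne_zero_of_mul hne)
    have hy'0 : 0 < ‖y' x - u‖ := norm_pos_iff.2 (right_ne_zero_of_mul hne)
    have hx0 : 0 < ‖x - u‖ := norm_pos_iff.2 (sub_ne_zero.2 hx3)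
    have b1 : log ‖y x - u‖ ≤ log M := log_le_log hy0
      ((norm_sub_le _ _).trans (by linarith [hyK x hxs]))
    have b2 : log ‖y' x - u‖ ≤ log M := log_le_log hy'0
      ((norm_sub_le _ _).trans (by linarith [hyK' x hxs]))
    have b3 : log ‖x - u‖ ≤ log M := log_le_log hx0
      ((norm_sub_le _ _).trans (by rw [hnorm x hxs]; nlinarith))
    have b4 : log ‖y x - u‖ + log ‖y' x - u‖ = log ‖x - c₁‖ + log ‖x - c₂‖ := by
      rw [← log_mul hy0.ne' hy'0.ne', ← norm_mul, hpx, norm_mul, log_mul]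
      · exact norm_ne_zero_iff.2 (sub_ne_zero.2 hx1)
      · exact norm_ne_zero_iff.2 (sub_ne_zero.2 hx2)
    simp only [Pi.sub_apply]
    rw [abs_le]
    -- Each of `log ‖y - u‖`, `log ‖y' - u‖`, `log ‖x - u‖` lies below `log M`, so the difference of
    -- the first and third is at most the sum of all three defects from `log M`. In that sum `y` and
    -- `y'` occur only through their product, which is explicit in `x`.
    constructor <;> linarith
  refine key.trans ?_
  have j1 : CircleIntegrable (fun x => 3 * log M - log ‖x - c₁‖) 0 r := i0.sub (i c₁)
  have j2 : CircleIntegrable (fun x => 3 * log M - log ‖x - c₁‖ - log ‖x - c₂‖) 0 r :=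
    j1.sub (i c₂)
  rw [circleAverage_fun_sub j2 (i u), circleAverage_fun_sub j1 (i c₂),
    circleAverage_fun_sub i0 (i c₁),
    circleAverage_const,
    circleAverage_log_norm_sub_const_eq_log_radius_add_posLog hr.ne',
    circleAverage_log_norm_sub_const_eq_log_radius_add_posLog hr.ne',
    circleAverage_log_norm_sub_const_eq_log_radius_add_posLog hr.ne']
  simp only [zero_sub, norm_neg]
  set t := r⁻¹ * ‖u‖ with ht
  have ht0 : 0 ≤ t := by positivity
  have e1 : log M = log r + log (t + K) := by
    rw [← log_mul hr.ne' (by positivity)]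
    congr 1
    rw [hM, ht]
    field_simp
  have e2 : log (t + K) ≤ log 2 + log⁺ t + log⁺ K :=
    (le_max_right 0 _).trans posLog_add
  have e3 := posLog_mul (x := r⁻¹ * ‖c₁‖) (y := r⁻¹ * ‖c₂‖)
  have e4 : r⁻¹ * ‖c₁‖ * (r⁻¹ * ‖c₂‖) = (r⁻¹) ^ 2 * ‖u ^ 2 + β‖ := by
    rw [← hcc, norm_mul]; ring
  -- This makes the bound uniform in `u`: the three terms `log⁺ t` coming from `3 log M` are
  -- absorbed by the mean of `log ‖x - u‖` and, through `c₁ c₂ = u² + β`, by the means for `c₁` and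
  -- `c₂`.
  have e5 : t ^ 2 ≤ (r⁻¹) ^ 2 * ‖u ^ 2 + β‖ + 1 := by
    have h1 : ‖u‖ ^ 2 ≤ ‖u ^ 2 + β‖ + r ^ 2 := by
      rw [← norm_pow]
      calc ‖u ^ 2‖ = ‖(u ^ 2 + β) - β‖ := by ring_nf
        _ ≤ ‖u ^ 2 + β‖ + ‖β‖ := norm_sub_le _ _
        _ ≤ _ := by linarith
    have h2 := mul_le_mul_of_nonneg_left h1 (sq_nonneg (r⁻¹))
    have h3 : (r⁻¹) ^ 2 * r ^ 2 = 1 := by field_simp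
    rw [ht, mul_pow]
    linarith
  have e6 := posLog_le_posLog (sq_nonneg t) e5
  have e7 := posLog_add (x := (r⁻¹) ^ 2 * ‖u ^ 2 + β‖) (y := 1)
  rw [posLog_pow] at e6
  rw [posLog_one] at e7
  rw [e4] at e3
  push_cast at e6
  linarith

end AskeyWilson

namespace AskeyWilson

open Real Metric MeromorphicOn

/-! ### The Joukowski map and its inverse branch -/

/-- The Joukowski map `z ↦ (z + 1/z)/2`. -/
noncomputable def joukowski (z : ℂ) : ℂ := (z + z⁻¹) / 2

theorem joukowski_eq_iff {z x : ℂ} (hz : z ≠ 0) : joukowski z = x ↔ (z - x) ^ 2 = x ^ 2 - 1 := by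
  rw [joukowski, div_eq_iff two_ne_zero]
  constructor
  · intro h
    have h1 : z * z⁻¹ = 1 := mul_inv_cancel₀ hz
    linear_combination z * h - h1
  · intro h
    have h1 : z * z⁻¹ = 1 := mul_inv_cancel₀ hz
    apply mul_left_cancel₀ hz
    linear_combination h + h1

theorem ne_zero_of_sub_sq_eq {z x : ℂ} (h : (z - x) ^ 2 = x ^ 2 - 1) : z ≠ 0 := by
  rintro rfl
  have : (1 : ℂ) = 0 := by linear_combination h
  exact one_ne_zero this

theorem eq_or_eq_inv_of_joukowski_eq {z w : ℂ} (hz : z ≠ 0) (hw : w ≠ 0)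
    (h : joukowski z = joukowski w) : z = w ∨ z = w⁻¹ := by
  have h1 : z * z⁻¹ = 1 := mul_inv_cancel₀ hz
  have h2 : w * w⁻¹ = 1 := mul_inv_cancel₀ hw
  unfold joukowski at h
  have h3 : (z - w) * (z - w⁻¹) = 0 := by linear_combination 2 * z * h + h2 - h1
  rcases mul_eq_zero.1 h3 with h | h
  · exact Or.inl (sub_eq_zero.1 h)
  · exact Or.inr (sub_eq_zero.1 h)

theorem sq_cpow_half (w : ℂ) : (w ^ (1 / 2 : ℂ)) ^ 2 = w := by
  have := Complex.cpow_nat_inv_pow w (n := 2) two_ne_zero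
  simpa only [one_div, Nat.cast_ofNat] using this

theorem cpow_half_re_nonneg (w : ℂ) : 0 ≤ (w ^ (1 / 2 : ℂ)).re := by
  rcases eq_or_ne w 0 with rfl | hw
  · simp
  rw [Complex.cpow_def_of_ne_zero hw, Complex.exp_re]
  apply mul_nonneg (exp_pos _).le
  have h : (Complex.log w * (1 / 2)).im = w.arg / 2 := by
    simp [Complex.mul_im, Complex.log_im, div_eq_mul_inv]
  rw [h]
  apply cos_nonneg_of_neg_pi_div_two_le_of_le
  · linarith [Complex.neg_pi_lt_arg w]
  · linarith [Complex.arg_le_pi w]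

theorem cpow_half_im_nonneg {w : ℂ} (hw : 0 ≤ w.im) : 0 ≤ (w ^ (1 / 2 : ℂ)).im := by
  rcases eq_or_ne w 0 with rfl | hw0
  · simp
  rw [Complex.cpow_def_of_ne_zero hw0, Complex.exp_im]
  apply mul_nonneg (exp_pos _).le
  have h : (Complex.log w * (1 / 2)).im = w.arg / 2 := by
    simp [Complex.mul_im, Complex.log_im, div_eq_mul_inv]
  rw [h]
  have := Complex.arg_nonneg_iff.2 hw
  apply sin_nonneg_of_nonneg_of_le_pi
  · linarith
  · linarith [Complex.arg_le_pi w, pi_pos]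

theorem cpow_half_im_nonpos {w : ℂ} (hw : w.im < 0) : (w ^ (1 / 2 : ℂ)).im ≤ 0 := by
  have hw0 : w ≠ 0 := by
    rintro rfl
    simp at hw
  rw [Complex.cpow_def_of_ne_zero hw0, Complex.exp_im]
  apply mul_nonpos_of_nonneg_of_nonpos (exp_pos _).le
  have h : (Complex.log w * (1 / 2)).im = w.arg / 2 := by
    simp [Complex.mul_im, Complex.log_im, div_eq_mul_inv]
  rw [h]
  have := Complex.arg_neg_iff.2 hw
  apply sin_nonpos_of_nonpos_of_neg_pi_le
  · linarith
  · linarith [Complex.neg_pi_lt_arg w, pi_pos]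

theorem zBranch_sub_sq (x : ℂ) : (zBranch x - x) ^ 2 = x ^ 2 - 1 := by
  have h1 := sq_cpow_half (x - 1)
  have h2 := sq_cpow_half (x + 1)
  rw [zBranch, add_sub_cancel_left, mul_pow, h1, h2]
  ring

theorem zBranch_ne_zero (x : ℂ) : zBranch x ≠ 0 := ne_zero_of_sub_sq_eq (zBranch_sub_sq x)

theorem joukowski_zBranch (x : ℂ) : joukowski (zBranch x) = x :=
  (joukowski_eq_iff (zBranch_ne_zero x)).2 (zBranch_sub_sq x)

/-- With `a = √(x+1)` and `b = √(x-1)` one has `z = (a + b)² / 2` and `|a + b| |a - b| = 2`. The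
principal roots have nonnegative real parts and imaginary parts of a common sign, so `|a - b| ≤ |a +
b|` and hence `|a + b|² ≥ 2`. -/
theorem one_le_norm_zBranch (x : ℂ) : 1 ≤ ‖zBranch x‖ := by
  set a := (x + 1) ^ (1 / 2 : ℂ) with ha
  set b := (x - 1) ^ (1 / 2 : ℂ) with hb
  have ha2 : a ^ 2 = x + 1 := sq_cpow_half _
  have hb2 : b ^ 2 = x - 1 := sq_cpow_half _
  have hz : zBranch x = (a + b) ^ 2 / 2 := by
    rw [zBranch, ← ha, ← hb]
    linear_combination (-1 / 2 : ℂ) * ha2 - (1 / 2 : ℂ) * hb2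
  have hprod : ‖a + b‖ * ‖a - b‖ = 2 := by
    rw [← norm_mul]
    have : (a + b) * (a - b) = 2 := by linear_combination ha2 - hb2
    rw [this]
    simp
  have hre : 0 ≤ a.re * b.re := mul_nonneg (cpow_half_re_nonneg _) (cpow_half_re_nonneg _)
  have him : 0 ≤ a.im * b.im := by
    rcases le_or_gt 0 x.im with h | h
    · exact mul_nonneg (cpow_half_im_nonneg (by simpa using h))
        (cpow_half_im_nonneg (by simpa using h))
    · exact mul_nonneg_of_nonpos_of_nonpos (cpow_half_im_nonpos (by simpa using h))
        (cpow_half_im_nonpos (by simpa using h))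
  have hsq : ‖a - b‖ ^ 2 ≤ ‖a + b‖ ^ 2 := by
    rw [← Complex.normSq_eq_norm_sq, ← Complex.normSq_eq_norm_sq, Complex.normSq_apply,
      Complex.normSq_apply]
    simp only [Complex.add_re, Complex.add_im, Complex.sub_re, Complex.sub_im]
    nlinarith
  have hle : ‖a - b‖ ≤ ‖a + b‖ := by
    rwa [sq_le_sq₀ (norm_nonneg _) (norm_nonneg _)] at hsq
  rw [hz, norm_div, norm_pow, Complex.norm_ofNat, le_div_iff₀ two_pos]
  nlinarith [norm_nonneg (a + b)]

theorem zBranch_joukowski {z : ℂ} (hz : 1 < ‖z‖) : zBranch (joukowski z) = z := by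
  have hz0 : z ≠ 0 := by rw [← norm_pos_iff]; linarith
  rcases eq_or_eq_inv_of_joukowski_eq (zBranch_ne_zero (joukowski z)) hz0
    (joukowski_zBranch (joukowski z)) with h | h
  · exact h
  · have h1 := one_le_norm_zBranch (joukowski z)
    rw [h, norm_inv] at h1
    have := inv_lt_one_of_one_lt₀ hz
    linarith

theorem norm_le_norm_zBranch (x : ℂ) : ‖x‖ ≤ ‖zBranch x‖ := by
  have h := one_le_norm_zBranch x
  conv_lhs => rw [← joukowski_zBranch x]
  rw [joukowski, norm_div, Complex.norm_ofNat, div_le_iff₀ two_pos]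
  have h1 := norm_add_le (zBranch x) (zBranch x)⁻¹
  have h2 : ‖(zBranch x)⁻¹‖ ≤ 1 := by
    rw [norm_inv]
    exact inv_le_one_of_one_le₀ h
  linarith

theorem exists_analyticAt_joukowski_section {x z₀ : ℂ} (h1 : x ≠ 1) (h2 : x ≠ -1) (hz₀ : z₀ ≠ 0)
    (h : joukowski z₀ = x) :
    ∃ ζ : ℂ → ℂ, AnalyticAt ℂ ζ x ∧ ζ x = z₀ ∧ ∀ y, ζ y ≠ 0 ∧ joukowski (ζ y) = y := by
  have hc := (joukowski_eq_iff hz₀).1 h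
  set c := z₀ - x with hcdef
  have hx : x ^ 2 - 1 ≠ 0 := by
    have : x ^ 2 - 1 = (x - 1) * (x + 1) := by ring
    rw [this]
    refine mul_ne_zero (sub_ne_zero.2 h1) ?_
    rwa [ne_eq, add_eq_zero_iff_eq_neg]
  have hc0 : c ≠ 0 := by
    intro h0
    rw [h0] at hc
    apply hx
    rw [← hc]
    simp
  have hsq : ∀ y, (y + c * ((y ^ 2 - 1) / c ^ 2) ^ (1 / 2 : ℂ) - y) ^ 2 = y ^ 2 - 1 := by
    intro y
    rw [add_sub_cancel_left, mul_pow, sq_cpow_half, mul_div_cancel₀ _ (pow_ne_zero 2 hc0)]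
  -- Dividing by `c ^ 2` makes the radicand `1` at `x`, safely inside the slit plane, and selects
  -- the root with value `c`. This works across the cut `[-1, 1]`, where `zBranch` itself may jump.
  refine ⟨fun y => y + c * ((y ^ 2 - 1) / c ^ 2) ^ (1 / 2 : ℂ), ?_, ?_, ?_⟩
  · apply analyticAt_id.add
    apply analyticAt_const.mul
    apply AnalyticAt.cpow
    · fun_prop (disch := simpa using hc0)
    · fun_prop
    · rw [hc, div_self hx]
      exact Complex.one_mem_slitPlane
  · simp only
    rw [hc, div_self hx, Complex.one_cpow]
    rw [hcdef]
    ring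
  · intro y
    have h0 := ne_zero_of_sub_sq_eq (hsq y)
    exact ⟨h0, (joukowski_eq_iff h0).2 (hsq y)⟩

theorem joukowski_eq_one_iff {z : ℂ} (hz : z ≠ 0) : joukowski z = 1 ↔ z = 1 := by
  rw [joukowski_eq_iff hz, one_pow, sub_self, pow_eq_zero_iff two_ne_zero, sub_eq_zero]

theorem joukowski_eq_neg_one_iff {z : ℂ} (hz : z ≠ 0) : joukowski z = -1 ↔ z = -1 := by
  rw [joukowski_eq_iff hz, neg_sq, one_pow, sub_self, pow_eq_zero_iff two_ne_zero, sub_eq_zero]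

theorem analyticAt_zBranch {x : ℂ} (hx : 1 < ‖zBranch x‖) : AnalyticAt ℂ zBranch x := by
  have h1 : x ≠ 1 := by
    intro h
    have := (joukowski_eq_one_iff (zBranch_ne_zero x)).1 (by rw [joukowski_zBranch, h])
    rw [this] at hx
    simp at hx
  have h2 : x ≠ -1 := by
    intro h
    have := (joukowski_eq_neg_one_iff (zBranch_ne_zero x)).1 (by rw [joukowski_zBranch, h])
    rw [this] at hx
    simp at hx
  obtain ⟨ζ, hζ, hζx, hζy⟩ := exists_analyticAt_joukowski_section h1 h2 (zBranch_ne_zero x)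
    (joukowski_zBranch x)
  refine hζ.congr ?_
  have : ∀ᶠ y in 𝓝 x, 1 < ‖ζ y‖ := by
    apply hζ.continuousAt.norm.eventually_const_lt
    simpa only [hζx] using hx
  filter_upwards [this] with y hy
  rw [← zBranch_joukowski hy, (hζy y).2]

/-! ### The shifted points -/

theorem checkPt_eq_hatPt_inv (s x : ℂ) : checkPt s x = hatPt s⁻¹ x := by
  simp [checkPt, hatPt]

theorem hatPt_eq_joukowski (s x : ℂ) : hatPt s x = joukowski (s * zBranch x) := by
  rw [hatPt, joukowski, mul_inv]

theorem checkPt_eq_joukowski (s x : ℂ) : checkPt s x = joukowski (s⁻¹ * zBranch x) := by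
  rw [checkPt_eq_hatPt_inv, hatPt_eq_joukowski]

theorem hatPt_eq (s x : ℂ) : hatPt s x = s * x + (s⁻¹ - s) * (zBranch x)⁻¹ / 2 := by
  have h := joukowski_zBranch x
  unfold joukowski at h
  rw [hatPt]
  linear_combination (s : ℂ) * h

theorem hatPt_add_checkPt (s x : ℂ) : hatPt s x + checkPt s x = 2 * ((s + s⁻¹) / 2) * x := by
  rw [checkPt_eq_hatPt_inv, hatPt_eq, hatPt_eq, inv_inv]
  ring

theorem hatPt_mul_checkPt {s : ℂ} (hs : s ≠ 0) (x : ℂ) :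
    hatPt s x * checkPt s x = x ^ 2 + (s - s⁻¹) ^ 2 / 4 := by
  have h := joukowski_zBranch x
  have hz : zBranch x * (zBranch x)⁻¹ = 1 := mul_inv_cancel₀ (zBranch_ne_zero x)
  have hs1 : s * s⁻¹ = 1 := mul_inv_cancel₀ hs
  unfold joukowski at h
  rw [hatPt, checkPt]
  set z := zBranch x
  set w := z⁻¹
  set t := s⁻¹
  conv_rhs => rw [← h]
  linear_combination (z ^ 2 / 4 + w ^ 2 / 4 + 1 / 2) * hs1 + (s ^ 2 / 4 + t ^ 2 / 4 - 1 / 2) * hz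

/-- The bound for the deviation of `hatPt s` and `checkPt s` from linear maps. -/
noncomputable def shiftDefect (s : ℂ) : ℝ := (‖s‖⁻¹ + ‖s‖) / 2

theorem norm_hatPt_sub_le (s x : ℂ) : ‖hatPt s x - s * x‖ ≤ shiftDefect s := by
  rw [hatPt_eq, add_sub_cancel_left, norm_div, norm_mul, Complex.norm_ofNat, shiftDefect]
  have h1 : ‖(zBranch x)⁻¹‖ ≤ 1 := by
    rw [norm_inv]
    exact inv_le_one_of_one_le₀ (one_le_norm_zBranch x)
  have h2 : ‖s⁻¹ - s‖ ≤ ‖s‖⁻¹ + ‖s‖ := by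
    rw [← norm_inv]
    exact norm_sub_le _ _
  have h3 : ‖s⁻¹ - s‖ * ‖(zBranch x)⁻¹‖ ≤ (‖s‖⁻¹ + ‖s‖) * 1 := by gcongr
  linarith

theorem norm_hatPt_le (s x : ℂ) : ‖hatPt s x‖ ≤ ‖s‖ * ‖x‖ + shiftDefect s := by
  have h := norm_hatPt_sub_le s x
  have h1 := norm_sub_norm_le (hatPt s x) (s * x)
  rw [norm_mul] at h1
  linarith

theorem le_norm_hatPt (s x : ℂ) : ‖s‖ * ‖x‖ - shiftDefect s ≤ ‖hatPt s x‖ := by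
  have h := norm_hatPt_sub_le s x
  have h1 := norm_sub_norm_le (s * x) (hatPt s x)
  rw [norm_mul, norm_sub_rev] at h1
  linarith

theorem shiftDefect_inv (s : ℂ) : shiftDefect s⁻¹ = shiftDefect s := by
  simp [shiftDefect, add_comm]

theorem norm_checkPt_le (s x : ℂ) : ‖checkPt s x‖ ≤ ‖s‖⁻¹ * ‖x‖ + shiftDefect s := by
  rw [checkPt_eq_hatPt_inv, ← shiftDefect_inv, ← norm_inv]
  exact norm_hatPt_le _ _

theorem le_norm_checkPt (s x : ℂ) : ‖s‖⁻¹ * ‖x‖ - shiftDefect s ≤ ‖checkPt s x‖ := by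
  rw [checkPt_eq_hatPt_inv, ← shiftDefect_inv, ← norm_inv]
  exact le_norm_hatPt _ _

theorem zBranch_hatPt {s x : ℂ} (h : 1 < ‖s‖ * ‖x‖) : zBranch (hatPt s x) = s * zBranch x := by
  rw [hatPt_eq_joukowski, zBranch_joukowski]
  rw [norm_mul]
  exact h.trans_le (mul_le_mul_of_nonneg_left (norm_le_norm_zBranch x) (norm_nonneg s))

theorem checkPt_hatPt {s x : ℂ} (h : 1 < ‖s‖ * ‖x‖) : checkPt s (hatPt s x) = x := by
  have hs : s ≠ 0 := by
    rintro rfl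
    simp at h
    linarith
  rw [checkPt_eq_joukowski, zBranch_hatPt h, inv_mul_cancel_left₀ hs, joukowski_zBranch]

theorem hatPt_checkPt {s x : ℂ} (h : 1 < ‖s‖⁻¹ * ‖x‖) : hatPt s (checkPt s x) = x := by
  rw [checkPt_eq_hatPt_inv]
  have := checkPt_hatPt (s := s⁻¹) (x := x) (by rwa [norm_inv])
  rwa [checkPt_eq_hatPt_inv, inv_inv] at this

theorem analyticAt_hatPt (s : ℂ) {x : ℂ} (hx : 1 < ‖x‖) : AnalyticAt ℂ (hatPt s) x := by
  have hz : AnalyticAt ℂ zBranch x := analyticAt_zBranch (hx.trans_le (norm_le_norm_zBranch x))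
  unfold hatPt
  fun_prop (disch := exact zBranch_ne_zero x)

theorem analyticAt_checkPt (s : ℂ) {x : ℂ} (hx : 1 < ‖x‖) : AnalyticAt ℂ (checkPt s) x := by
  have : checkPt s = hatPt s⁻¹ := funext (checkPt_eq_hatPt_inv s)
  rw [this]
  exact analyticAt_hatPt s⁻¹ hx

/-- `checkPt s` is a local left inverse, so the chain rule excludes a vanishing derivative. -/
theorem deriv_hatPt_ne_zero {s x : ℂ} (hx : 1 < ‖x‖) (h : 1 < ‖s‖ * ‖x‖)
    (hy : 1 < ‖hatPt s x‖) : deriv (hatPt s) x ≠ 0 := by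
  have h1 : checkPt s ∘ hatPt s =ᶠ[𝓝 x] id := by
    have : ∀ᶠ y in 𝓝 x, 1 < ‖s‖ * ‖y‖ :=
      (continuous_const.mul continuous_norm).continuousAt.eventually_const_lt h
    filter_upwards [this] with y hy
    exact checkPt_hatPt hy
  have h2 := h1.deriv_eq
  rw [deriv_comp x (analyticAt_checkPt s hy).differentiableAt
    (analyticAt_hatPt s hx).differentiableAt, deriv_id] at h2
  intro h3
  rw [h3, mul_zero] at h2
  exact zero_ne_one h2

theorem not_eventuallyConst_of_deriv_ne_zero {y : ℂ → ℂ} {x : ℂ} (h : deriv y x ≠ 0) :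
    ¬ EventuallyConst y (𝓝 x) := by
  intro hc
  rw [eventuallyConst_iff_exists_eventuallyEq] at hc
  obtain ⟨c, hc⟩ := hc
  apply h
  rw [hc.deriv_eq]
  simp

end AskeyWilson

namespace AskeyWilson

open Real Metric MeromorphicOn

/-! ### Meromorphy of the Askey-Wilson divided difference -/

/-- The divided difference `D_q f` in the uniformizing variable `z`. -/
noncomputable def awOpUniformized (s : ℂ) (f : ℂ → ℂ) (z : ℂ) : ℂ :=
  (f (joukowski (s * z)) - f (joukowski (s⁻¹ * z))) / (joukowski (s * z) - joukowski (s⁻¹ * z))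

theorem joukowski_inv (z : ℂ) : joukowski z⁻¹ = joukowski z := by
  rw [joukowski, joukowski, inv_inv, add_comm]

theorem awOp_eq {s : ℂ} {f : ℂ → ℂ} {x : ℂ} (h1 : x ≠ 1) (h2 : x ≠ -1) :
    awOp s f x = (f (hatPt s x) - f (checkPt s x)) / (hatPt s x - checkPt s x) := by
  rw [awOp, if_neg h1, if_neg h2]

/-- The choice of preimage is immaterial: `z ↦ 1/z` swaps the two shifted points, and the divided
difference is symmetric in them. This is what makes `D_q f` meromorphic across the cut of `zBranch`.
-/
theorem awOp_joukowski {s : ℂ} {f : ℂ → ℂ} {z : ℂ} (hz : z ≠ 0) (h1 : joukowski z ≠ 1)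
    (h2 : joukowski z ≠ -1) : awOp s f (joukowski z) = awOpUniformized s f z := by
  rw [awOp_eq h1 h2, awOpUniformized, hatPt_eq_joukowski, checkPt_eq_joukowski]
  rcases eq_or_eq_inv_of_joukowski_eq (zBranch_ne_zero _) hz (joukowski_zBranch (joukowski z))
    with h | h
  · rw [h]
  · have e1 : joukowski (s * z⁻¹) = joukowski (s⁻¹ * z) := by
      rw [← joukowski_inv, mul_inv, inv_inv]
    have e2 : joukowski (s⁻¹ * z⁻¹) = joukowski (s * z) := by
      rw [← joukowski_inv, mul_inv, inv_inv, inv_inv]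
    rw [h, e1, e2, ← neg_sub, ← neg_sub (joukowski (s * z)), neg_div_neg_eq]

theorem meromorphicAt_awOpUniformized {s : ℂ} (hs : s ≠ 0) {f : ℂ → ℂ} (hf : Meromorphic f) {z : ℂ}
    (hz : z ≠ 0) : MeromorphicAt (awOpUniformized s f) z := by
  have h : ∀ t : ℂ, t ≠ 0 → AnalyticAt ℂ (fun w => joukowski (t * w)) z := by
    intro t ht
    unfold joukowski
    fun_prop (disch := exact mul_ne_zero ht hz)
  have h1 := h s hs
  have h2 := h s⁻¹ (inv_ne_zero hs)
  unfold awOpUniformized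
  exact (((hf _).comp_analyticAt h1).sub ((hf _).comp_analyticAt h2)).div
    (h1.meromorphicAt.sub h2.meromorphicAt)

theorem awOp_eventuallyEq_comp {s : ℂ} {f ζ : ℂ → ℂ} {x : ℂ} (h1 : x ≠ 1) (h2 : x ≠ -1)
    (hζ : ∀ y, ζ y ≠ 0 ∧ joukowski (ζ y) = y) :
    (fun y => awOpUniformized s f (ζ y)) =ᶠ[𝓝 x] awOp s f := by
  filter_upwards [eventually_ne_nhds h1, eventually_ne_nhds h2] with y hy1 hy2
  rw [← awOp_joukowski (hζ y).1, (hζ y).2]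
  · rwa [(hζ y).2]
  · rwa [(hζ y).2]

theorem meromorphicAt_awOp_of_ne {s : ℂ} (hs : s ≠ 0) {f : ℂ → ℂ} (hf : Meromorphic f) {x : ℂ}
    (h1 : x ≠ 1) (h2 : x ≠ -1) : MeromorphicAt (awOp s f) x := by
  obtain ⟨ζ, hζ, -, hζy⟩ := exists_analyticAt_joukowski_section h1 h2 (zBranch_ne_zero x)
    (joukowski_zBranch x)
  exact ((meromorphicAt_awOpUniformized hs hf (hζy x).1).comp_analyticAt hζ).congr
    ((awOp_eventuallyEq_comp h1 h2 hζy).filter_mono nhdsWithin_le_nhds)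

theorem tendsto_zBranch_nhdsNE {p : ℂ} (hp : p ^ 2 = 1) :
    Tendsto zBranch (𝓝[≠] p) (𝓝[≠] p) := by
  have h1 : Tendsto (fun y => ‖zBranch y - y‖ ^ 2) (𝓝 p) (𝓝 0) := by
    have : (fun y => ‖zBranch y - y‖ ^ 2) = fun y => ‖y ^ 2 - 1‖ := by
      ext y
      rw [← norm_pow, zBranch_sub_sq]
    rw [this]
    have hc : Continuous fun y : ℂ => ‖y ^ 2 - 1‖ := by fun_prop
    have := hc.tendsto p
    simpa [hp] using this
  have h2 : Tendsto (fun y => ‖zBranch y - y‖) (𝓝 p) (𝓝 0) := by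
    have := h1.sqrt
    simpa [sqrt_sq (norm_nonneg _)] using this
  have h3 : Tendsto zBranch (𝓝 p) (𝓝 p) := by
    have := (tendsto_zero_iff_norm_tendsto_zero.2 h2).add (tendsto_id (α := ℂ) (x := 𝓝 p))
    simpa using this
  refine tendsto_nhdsWithin_iff.2 ⟨h3.mono_left nhdsWithin_le_nhds, ?_⟩
  filter_upwards [self_mem_nhdsWithin] with y hy h
  apply hy
  have hp0 : p ≠ 0 := by
    rintro rfl
    simp at hp
  have hpi : p⁻¹ = p := inv_eq_of_mul_eq_one_left (by rw [← sq, hp])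
  have h := joukowski_zBranch y
  rw [Set.mem_singleton_iff] at *
  rw [‹zBranch y = p›, joukowski, hpi] at h
  rw [← h]
  ring

theorem joukowski_sub {p z : ℂ} (hp : p ^ 2 = 1) (hz : z ≠ 0) :
    joukowski z - p = (z - p) ^ 2 / (2 * z) := by
  rw [joukowski]
  field_simp
  linear_combination -hp

/-- At the branch points `±1` there is no analytic section of the Joukowski map. Instead, `(y - p) ^
n * D_q f` is analytic and bounded on a punctured neighbourhood, and Riemann's removable singularity
theorem applies. -/
theorem meromorphicAt_awOp_of_sq_eq_one {s : ℂ} (hs : s ≠ 0) {f : ℂ → ℂ} (hf : Meromorphic f)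
    {p : ℂ} (hp : p ^ 2 = 1) : MeromorphicAt (awOp s f) p := by
  have hp0 : p ≠ 0 := by
    rintro rfl
    simp at hp
  have hΦ := meromorphicAt_awOpUniformized hs hf hp0
  obtain ⟨n, hn⟩ := id hΦ
  have hlim := tendsto_zBranch_nhdsNE hp
  set C := ‖(p - p) ^ n • awOpUniformized s f p‖ + 1 with hC
  have b1 : ∀ᶠ z in 𝓝[≠] p, ‖(z - p) ^ n • awOpUniformized s f z‖ < C :=
    (hn.continuousAt.norm.eventually_lt_const (by simp [hC])).filter_mono nhdsWithin_le_nhds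
  have b2 : ∀ᶠ z in 𝓝[≠] p, ‖z - p‖ < 1 := by
    apply Eventually.filter_mono nhdsWithin_le_nhds
    have hc : Continuous fun z : ℂ => ‖z - p‖ := by fun_prop
    apply hc.continuousAt.eventually_lt_const
    simp
  have hne : ∀ᶠ y in 𝓝[≠] p, y ≠ 1 ∧ y ≠ -1 := by
    have hpp : p = 1 ∨ p = -1 := sq_eq_sq_iff_eq_or_eq_neg.1 (by simpa using hp)
    rcases hpp with rfl | rfl
    · filter_upwards [self_mem_nhdsWithin,
        nhdsWithin_le_nhds (eventually_ne_nhds (b := (-1 : ℂ)) (by norm_num))] with y h1 h2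
      exact ⟨h1, h2⟩
    · filter_upwards [self_mem_nhdsWithin,
        nhdsWithin_le_nhds (eventually_ne_nhds (b := (1 : ℂ)) (by norm_num))] with y h1 h2
      exact ⟨h2, h1⟩
  have hdiff : ∀ᶠ y in 𝓝[≠] p, DifferentiableAt ℂ (fun y => (y - p) ^ n * awOp s f y) y := by
    filter_upwards [hlim.eventually hΦ.eventually_analyticAt, hne] with y hy ⟨h1, h2⟩
    obtain ⟨ζ, hζ, hζx, hζy⟩ := exists_analyticAt_joukowski_section h1 h2 (zBranch_ne_zero y)
      (joukowski_zBranch y)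
    rw [← hζx] at hy
    have : AnalyticAt ℂ (awOp s f) y :=
      (hy.comp hζ).congr (awOp_eventuallyEq_comp h1 h2 hζy)
    have := this.differentiableAt
    fun_prop
  have hbdd : ∀ᶠ y in 𝓝[≠] p, ‖(y - p) ^ n * awOp s f y‖ ≤ C := by
    filter_upwards [hlim.eventually b1, hlim.eventually b2, hne] with y h1 h2 ⟨h3, h4⟩
    set z := zBranch y with hz
    have hz0 : z ≠ 0 := zBranch_ne_zero y
    have hzy : joukowski z = y := joukowski_zBranch y
    have e1 : awOp s f y = awOpUniformized s f z := by
      rw [← awOp_joukowski hz0 (by rwa [hzy]) (by rwa [hzy]), hzy]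
    have e2 : y - p = (z - p) ^ 2 / (2 * z) := by rw [← hzy, joukowski_sub hp hz0]
    -- `y - p` vanishes to second order in `z - p`, so one factor `(z - p) ^ n` cancels the pole of
    -- the uniformized function and the other is bounded.
    have e3 : (y - p) ^ n * awOp s f y =
        ((z - p) / (2 * z)) ^ n * ((z - p) ^ n • awOpUniformized s f z) := by
      rw [e1, e2, smul_eq_mul, ← mul_assoc, ← mul_pow]
      congr 2
      ring
    rw [e3, norm_mul, norm_pow, norm_div, norm_mul, Complex.norm_ofNat]
    have hz1 : 1 ≤ ‖z‖ := one_le_norm_zBranch y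
    have h5 : ‖z - p‖ / (2 * ‖z‖) ≤ 1 := by
      rw [div_le_one (by positivity)]
      linarith
    calc (‖z - p‖ / (2 * ‖z‖)) ^ n * ‖(z - p) ^ n • awOpUniformized s f z‖ ≤ 1 * C := by
          gcongr
          exact pow_le_one₀ (by positivity) h5
      _ = C := one_mul _
  obtain ⟨ε, hε, hball⟩ := Metric.mem_nhdsWithin_iff.1 (hdiff.and hbdd)
  have hd := Complex.differentiableOn_update_limUnder_of_bddAbove
    (f := fun y => (y - p) ^ n * awOp s f y) (s := ball p ε) (c := p) (ball_mem_nhds p hε)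
    (fun y hy => (hball ⟨hy.1, hy.2⟩).1.differentiableWithinAt)
    ⟨C, by
      rintro _ ⟨y, hy, rfl⟩
      exact (hball ⟨hy.1, hy.2⟩).2⟩
  have ha := (hd.analyticAt (ball_mem_nhds p hε)).meromorphicAt
  have hE : MeromorphicAt (fun y => (y - p) ^ n * awOp s f y) p := by
    refine ha.congr ?_
    filter_upwards [self_mem_nhdsWithin] with y hy
    rw [Function.update_of_ne hy]
  have hinv : MeromorphicAt (fun y => ((y - p) ^ n)⁻¹) p := by fun_prop
  refine (hinv.mul hE).congr ?_
  filter_upwards [self_mem_nhdsWithin] with y hy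
  simp only [Pi.mul_apply]
  rw [inv_mul_cancel_left₀ (pow_ne_zero n (sub_ne_zero.2 hy))]

theorem meromorphic_awOp {s : ℂ} (hs : s ≠ 0) {f : ℂ → ℂ} (hf : Meromorphic f) :
    Meromorphic (awOp s f) := by
  intro x
  by_cases h : x ^ 2 = 1
  · exact meromorphicAt_awOp_of_sq_eq_one hs hf h
  · refine meromorphicAt_awOp_of_ne hs hf ?_ ?_ <;> rintro rfl <;> simp at h

end AskeyWilson

/-! ### The identity theorem for meromorphic functions, and value divisors -/

namespace AskeyWilson

open Real Metric MeromorphicOn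

theorem order_ne_top_or_eventuallyEq_zero {g : ℂ → ℂ} (hg : Meromorphic g) :
    (∀ z, meromorphicOrderAt g z ≠ ⊤) ∨ g =ᶠ[codiscrete ℂ] 0 := by
  by_cases h : ∀ z, meromorphicOrderAt g z ≠ ⊤
  · exact Or.inl h
  right
  rw [← hg.exists_meromorphicOrderAt_ne_top_iff_forall] at h
  push Not at h
  rw [EventuallyEq, Filter.Eventually, mem_codiscrete]
  intro x
  rw [disjoint_principal_right, compl_compl]
  exact meromorphicOrderAt_eq_top_iff.1 (h x)

/-! ### Values and their divisors -/

/-- The divisor of the points where `f` takes the value `v`, finite or infinite. -/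
noncomputable def valueDivisor (f : ℂ → ℂ) : WithTop ℂ → Function.locallyFinsupp ℂ ℤ
  | ⊤ => (divisor f Set.univ)⁻
  | (a : ℂ) => (divisor (fun z => f z - a) Set.univ)⁺

theorem logCounting_eq_logCounting_valueDivisor (f : ℂ → ℂ) (v : WithTop ℂ) :
    ValueDistribution.logCounting f v
      = Function.locallyFinsuppWithin.logCounting (valueDivisor f v) := by
  cases v with
  | top => exact ValueDistribution.logCounting_top
  | coe a => exact ValueDistribution.logCounting_coe

theorem valueDivisor_nonneg (f : ℂ → ℂ) (v : WithTop ℂ) : 0 ≤ valueDivisor f v := by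
  cases v with
  | top => exact negPart_nonneg _
  | coe a => exact posPart_nonneg _

/-- The function whose zeros are the points where `f` takes the value `v`. -/
noncomputable def valueFunction (f : ℂ → ℂ) : WithTop ℂ → ℂ → ℂ
  | ⊤ => f⁻¹
  | (a : ℂ) => fun z => f z - a

/-- The function to which the divided difference is applied for the value `v`. -/
noncomputable def differenceFunction (f : ℂ → ℂ) : WithTop ℂ → ℂ → ℂ
  | ⊤ => f⁻¹
  | (_ : ℂ) => f

theorem awCount_eq (s : ℂ) (f : ℂ → ℂ) (v : WithTop ℂ) (r : ℝ) :
    awCount s f v r = ∑ᶠ x ∈ ball (0 : ℂ) r,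
      awMult s (valueFunction f v) (differenceFunction f v) x := by
  cases v <;> rfl

theorem zeroMult_eq {g : ℂ → ℂ} {x : ℂ} {n : ℤ} (h : meromorphicOrderAt g x = n) :
    zeroMult g x = (n.toNat : ℕ∞) := by
  rw [zeroMult, h]
  rfl

/-- `f` takes no value `a` identically. -/
def Nonconstant (f : ℂ → ℂ) : Prop := ∀ a z, meromorphicOrderAt (fun y => f y - a) z ≠ ⊤

theorem Nonconstant.order_ne_top {f : ℂ → ℂ} (h : Nonconstant f) (z : ℂ) :
    meromorphicOrderAt f z ≠ ⊤ := by
  simpa using h 0 z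

theorem exists_order_valueFunction {f : ℂ → ℂ} (hf : Meromorphic f) (hn : Nonconstant f)
    (v : WithTop ℂ) (x : ℂ) : ∃ n : ℤ, meromorphicOrderAt (valueFunction f v) x = n ∧
      valueDivisor f v x = max n 0 := by
  cases v with
  | top =>
    obtain ⟨n, h⟩ := WithTop.ne_top_iff_exists.1 (hn.order_ne_top x)
    refine ⟨-n, ?_, ?_⟩
    · change meromorphicOrderAt f⁻¹ x = _
      rw [meromorphicOrderAt_inv, ← h]
      rfl
    · change (divisor f Set.univ)⁻ x = _
      rw [Function.locallyFinsuppWithin.negPart_apply, divisor_apply hf.meromorphicOn (Set.mem_univ x), ← h]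
      rfl
  | coe a =>
    obtain ⟨n, h⟩ := WithTop.ne_top_iff_exists.1 (hn a x)
    refine ⟨n, h.symm, ?_⟩
    change (divisor (fun z => f z - a) Set.univ)⁺ x = _
    rw [Function.locallyFinsuppWithin.posPart_apply, divisor_apply _ (Set.mem_univ x), ← h]
    · rfl
    · exact fun z _ => (hf z).sub (MeromorphicAt.const a z)

theorem zeroMult_valueFunction {f : ℂ → ℂ} (hf : Meromorphic f) (hn : Nonconstant f)
    (v : WithTop ℂ) (x : ℂ) :
    zeroMult (valueFunction f v) x = ((valueDivisor f v x).toNat : ℕ∞) := by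
  obtain ⟨n, h1, h2⟩ := exists_order_valueFunction hf hn v x
  rw [zeroMult_eq h1, h2]
  congr 1
  omega

/-! ### Finiteness of the Askey-Wilson excess -/

/-- Every point of the support contributes at least `1`, so `C + 1` such points in a large disc
would exceed the bound. -/
theorem finite_support_of_finsum_ball_le {m : ℂ → ℕ∞}
    (hm : ∀ r, (ball (0 : ℂ) r ∩ Function.support m).Finite) {C : ℕ}
    (hC : ∀ᶠ r : ℝ in atTop, ∑ᶠ x ∈ ball (0 : ℂ) r, m x ≤ C) : (Function.support m).Finite := by
  by_contra hinf
  obtain ⟨T, hT, hcard⟩ := Set.Infinite.exists_subset_card_eq hinf (C + 1)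
  obtain ⟨B, hB⟩ := T.finite_toSet.isBounded.subset_ball (0 : ℂ)
  obtain ⟨r, hr, hrB⟩ := (hC.and (eventually_ge_atTop B)).exists
  -- Without `hm` the bound could hold vacuously, since a `finsum` over an infinite support is `0`
  -- by convention.
  rw [finsum_mem_eq_sum_of_inter_support_eq m (t := (hm r).toFinset) (by simp)] at hr
  have h1 : ((C + 1 : ℕ) : ℕ∞) ≤ ∑ x ∈ (hm r).toFinset, m x := by
    calc ((C + 1 : ℕ) : ℕ∞) = ∑ x ∈ T, (1 : ℕ∞) := by simp [hcard]
      _ ≤ ∑ x ∈ T, m x := Finset.sum_le_sum fun x hx =>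
          Order.one_le_iff_ne_zero.2 (hT hx)
      _ ≤ ∑ x ∈ (hm r).toFinset, m x := by
          apply Finset.sum_le_sum_of_subset
          intro x hx
          simp only [Set.Finite.mem_toFinset]
          exact ⟨ball_subset_ball hrB (hB hx), hT hx⟩
  have h2 := h1.trans hr
  rw [Nat.cast_le] at h2
  omega

theorem finite_inter_support_locallyFinsupp (D : Function.locallyFinsupp ℂ ℤ) (r : ℝ) :
    (closedBall (0 : ℂ) r ∩ D.support).Finite :=
  (Function.locallyFinsupp.locallyFiniteSupport D).finite_inter_support_of_isCompact
    (isCompact_closedBall 0 r)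

/-- The Picard hypothesis enters the proof only through this: outside a finite set `h - min h k' =
0`, that is, `h ≤ k'`. -/
theorem IsAWPicardValue.exists_zeroMult_le {s : ℂ} {f : ℂ → ℂ} (hf : Meromorphic f)
    (hn : Nonconstant f) {v : WithTop ℂ} (hv : IsAWPicardValue s f v) :
    ∃ R₀ : ℝ, ∀ x : ℂ, R₀ < ‖x‖ → ((valueDivisor f v x).toNat : ℕ∞) ≤
      zeroMult (awOp s (differenceFunction f v)) (hatPt s x) := by
  obtain ⟨C, hC⟩ := hv
  simp only [awCount_eq] at hC
  have hfin : (Function.support fun x =>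
      awMult s (valueFunction f v) (differenceFunction f v) x).Finite := by
    refine finite_support_of_finsum_ball_le (fun r => ?_) hC
    refine (finite_inter_support_locallyFinsupp (valueDivisor f v) r).subset ?_
    rintro x ⟨hx, hx2⟩
    refine ⟨ball_subset_closedBall hx, fun h => hx2 ?_⟩
    simp [awMult, zeroMult_valueFunction hf hn, h]
  obtain ⟨B, hB⟩ := hfin.isBounded.subset_closedBall (0 : ℂ)
  refine ⟨B, fun x hx => ?_⟩
  have h0 : awMult s (valueFunction f v) (differenceFunction f v) x = 0 := by
    by_contra h
    have := hB h
    rw [mem_closedBall_zero_iff] at this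
    linarith
  rw [awMult, tsub_eq_zero_iff_le, zeroMult_valueFunction hf hn] at h0
  exact h0.trans (min_le_right _ _)

/-! ### Disjointness of the value divisors -/

theorem valueDivisor_eq_zero_of_pos {f : ℂ → ℂ} (hf : Meromorphic f) (hn : Nonconstant f)
    {v w : WithTop ℂ} (hvw : v ≠ w) {x : ℂ} (hv : 0 < valueDivisor f v x) :
    valueDivisor f w x = 0 := by
  have hconst : ∀ c : ℂ, 0 ≤ meromorphicOrderAt (fun _ : ℂ => c) x := fun c =>
    (analyticAt_const).meromorphicOrderAt_nonneg
  have hmer : ∀ a : ℂ, MeromorphicAt (fun z => f z - a) x := fun a =>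
    (hf x).sub (MeromorphicAt.const a x)
  have key : ∀ a : ℂ, ∀ w : WithTop ℂ, (a : WithTop ℂ) ≠ w → 0 < valueDivisor f a x →
      ¬ 0 < valueDivisor f w x := by
    intro a w haw ha hw
    obtain ⟨n, h1, h2⟩ := exists_order_valueFunction hf hn a x
    obtain ⟨m, h3, h4⟩ := exists_order_valueFunction hf hn w x
    have hn0 : 0 < n := by omega
    have hm0 : 0 < m := by omega
    have h1' : meromorphicOrderAt (fun z => f z - a) x = n := h1
    cases w with
    | top =>
      have h3' : meromorphicOrderAt f⁻¹ x = m := h3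
      rw [meromorphicOrderAt_inv] at h3'
      have h5 := meromorphicOrderAt_add (hmer a) (MeromorphicAt.const a x)
      have e : (fun z => f z - a) + (fun _ => a) = f := by
        ext z
        simp
      rw [e, h1'] at h5
      have h6 : (0 : WithTop ℤ) ≤ meromorphicOrderAt f x :=
        (le_min (by exact_mod_cast hn0.le) (hconst a)).trans h5
      obtain ⟨k, hk⟩ := WithTop.ne_top_iff_exists.1 (hn.order_ne_top x)
      rw [← hk] at h6 h3'
      have h7 : -k = m := by exact_mod_cast h3'
      have h8 : 0 ≤ k := by exact_mod_cast h6
      omega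
    | coe b =>
      have h3' : meromorphicOrderAt (fun z => f z - b) x = m := h3
      have h5 := meromorphicOrderAt_add (hmer a) (hmer b).neg
      have hab : b - a ≠ 0 := by
        rw [sub_ne_zero]
        rintro rfl
        exact haw rfl
      have e : (fun z => f z - a) + -(fun z => f z - b) = fun _ => b - a := by
        ext z
        simp
      rw [e, h1', ← meromorphicOrderAt_neg, h3', meromorphicOrderAt_const, if_neg hab] at h5
      have h6 : (0 : WithTop ℤ) < min (n : WithTop ℤ) m :=
        lt_min (by exact_mod_cast hn0) (by exact_mod_cast hm0)
      exact absurd h5 (not_le.2 h6)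
  have hw0 : 0 ≤ valueDivisor f w x := valueDivisor_nonneg f w x
  by_contra hw
  have hw1 : 0 < valueDivisor f w x := lt_of_le_of_ne hw0 (Ne.symm hw)
  cases v with
  | top =>
    cases w with
    | top => exact hvw rfl
    | coe b => exact key b ⊤ hvw.symm hw1 hv
  | coe a => exact key a w hvw hv hw1

end AskeyWilson

namespace AskeyWilson

open Real Metric MeromorphicOn Bornology

/-! ### The shifted points near infinity -/

theorem eventually_cobounded_lt_norm (C : ℝ) : ∀ᶠ x : ℂ in cobounded ℂ, C < ‖x‖ :=
  tendsto_norm_cobounded_atTop.eventually_gt_atTop C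

theorem eventually_cobounded_lt_mul_norm {k : ℝ} (hk : 0 < k) (C : ℝ) :
    ∀ᶠ x : ℂ in cobounded ℂ, C < k * ‖x‖ :=
  (tendsto_norm_cobounded_atTop.const_mul_atTop hk).eventually_gt_atTop C

theorem tendsto_hatPt_cobounded {s : ℂ} (hs : s ≠ 0) :
    Tendsto (hatPt s) (cobounded ℂ) (cobounded ℂ) := by
  rw [← tendsto_norm_atTop_iff_cobounded]
  refine tendsto_atTop_mono (le_norm_hatPt s) ?_
  exact tendsto_atTop_add_const_right _ _
    (tendsto_norm_cobounded_atTop.const_mul_atTop (norm_pos_iff.2 hs))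

theorem tendsto_checkPt_cobounded {s : ℂ} (hs : s ≠ 0) :
    Tendsto (checkPt s) (cobounded ℂ) (cobounded ℂ) := by
  have : checkPt s = hatPt s⁻¹ := funext (checkPt_eq_hatPt_inv s)
  rw [this]
  exact tendsto_hatPt_cobounded (inv_ne_zero hs)

theorem eventually_one_le_norm_hatPt_sub_checkPt {s : ℂ} (hs : s ≠ 0) (hs1 : ‖s‖ < 1) :
    ∀ᶠ x in cobounded ℂ, 1 ≤ ‖hatPt s x - checkPt s x‖ := by
  have h0 : 0 < ‖s‖ := norm_pos_iff.2 hs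
  have h1 : 1 < ‖s‖⁻¹ := (one_lt_inv₀ h0).2 hs1
  filter_upwards [eventually_cobounded_lt_mul_norm (k := ‖s‖⁻¹ - ‖s‖) (by linarith)
    (1 + 2 * shiftDefect s)] with x hx
  have h2 := norm_hatPt_le s x
  have h3 := le_norm_checkPt s x
  have h4 := norm_sub_norm_le (checkPt s x) (hatPt s x)
  rw [norm_sub_rev] at h4
  linarith

theorem eventually_norm_hatPt_le {s : ℂ} (hs1 : ‖s‖ < 1) :
    ∀ᶠ x in cobounded ℂ, ‖hatPt s x‖ ≤ ‖x‖ := by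
  filter_upwards [eventually_cobounded_lt_mul_norm (k := 1 - ‖s‖) (by linarith)
    (shiftDefect s)] with x hx
  linarith [norm_hatPt_le s x]

theorem eventually_norm_checkPt_le (s : ℂ) :
    ∀ᶠ x in cobounded ℂ, ‖checkPt s x‖ ≤ (‖s‖⁻¹ + 1) * ‖x‖ := by
  filter_upwards [eventually_cobounded_lt_norm (shiftDefect s)] with x hx
  linarith [norm_checkPt_le s x]

theorem eventually_checkPt_hatPt {s : ℂ} (hs : s ≠ 0) :
    ∀ᶠ x in cobounded ℂ, checkPt s (hatPt s x) = x := by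
  filter_upwards [eventually_cobounded_lt_mul_norm (norm_pos_iff.2 hs) 1] with x hx
  exact checkPt_hatPt hx

theorem eventually_hatPt_checkPt {s : ℂ} (hs : s ≠ 0) :
    ∀ᶠ x in cobounded ℂ, hatPt s (checkPt s x) = x := by
  filter_upwards [eventually_cobounded_lt_mul_norm (inv_pos.2 (norm_pos_iff.2 hs)) 1] with x hx
  exact hatPt_checkPt hx

theorem eventually_deriv_hatPt_ne_zero {s : ℂ} (hs : s ≠ 0) :
    ∀ᶠ x in cobounded ℂ, deriv (hatPt s) x ≠ 0 := by
  filter_upwards [eventually_cobounded_lt_mul_norm (norm_pos_iff.2 hs) 1,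
    eventually_cobounded_lt_norm 1,
    (tendsto_hatPt_cobounded hs).eventually (eventually_cobounded_lt_norm 1)] with x h1 h2 h3
  exact deriv_hatPt_ne_zero h2 h1 h3

theorem eventually_deriv_checkPt_ne_zero {s : ℂ} (hs : s ≠ 0) :
    ∀ᶠ x in cobounded ℂ, deriv (checkPt s) x ≠ 0 := by
  have : checkPt s = hatPt s⁻¹ := funext (checkPt_eq_hatPt_inv s)
  rw [this]
  exact eventually_deriv_hatPt_ne_zero (inv_ne_zero hs)

/-! ### The divisor of the divided difference near infinity -/

theorem order_inv_eq_zero_of_ne_zero {g : ℂ → ℂ} {y : ℂ} (hg : AnalyticAt ℂ g y) (h : g y ≠ 0) :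
    meromorphicOrderAt g⁻¹ y = 0 := by
  have h1 := hg.inv h
  rw [h1.meromorphicOrderAt_eq, h1.analyticOrderAt_eq_zero.2 (inv_ne_zero h)]
  rfl

theorem awOp_eventuallyEq_nhds {s : ℂ} (f : ℂ → ℂ) {y : ℂ} (hy : 1 < ‖y‖) :
    awOp s f =ᶠ[𝓝 y] (f ∘ hatPt s + -(f ∘ checkPt s)) * (hatPt s - checkPt s)⁻¹ := by
  have h1 : y ≠ 1 := by rintro rfl; simp at hy
  have h2 : y ≠ -1 := by rintro rfl; simp at hy
  filter_upwards [eventually_ne_nhds h1, eventually_ne_nhds h2] with x hx1 hx2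
  rw [awOp_eq hx1 hx2, div_eq_mul_inv, sub_eq_add_neg (f _)]
  rfl

/-- Near infinity both shifts are locally biholomorphic and preserve orders, and the denominator of
`D_q` is a nonvanishing analytic function. The second relation is the quotient rule `D_q (1/f) =
-D_q f / (f(x̂) f(x̌))`. -/
theorem eventually_order_awOp {s : ℂ} (hs : s ≠ 0) (hs1 : ‖s‖ < 1) {f : ℂ → ℂ} (hf : Meromorphic f)
    (h0 : ∀ z, meromorphicOrderAt f z ≠ ⊤) :
    ∀ᶠ y in cobounded ℂ,
      min (meromorphicOrderAt f (hatPt s y)) (meromorphicOrderAt f (checkPt s y))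
        ≤ meromorphicOrderAt (awOp s f) y ∧
      meromorphicOrderAt (awOp s f⁻¹) y = meromorphicOrderAt (awOp s f) y -
        (meromorphicOrderAt f (hatPt s y) + meromorphicOrderAt f (checkPt s y)) := by
  filter_upwards [eventually_cobounded_lt_norm 1, eventually_deriv_hatPt_ne_zero hs,
    eventually_deriv_checkPt_ne_zero hs, eventually_one_le_norm_hatPt_sub_checkPt hs hs1]
    with y hy hd1 hd2 hsub
  have ha1 := analyticAt_hatPt s hy
  have ha2 := analyticAt_checkPt s hy
  have o1 : meromorphicOrderAt (f ∘ hatPt s) y = _ :=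
    meromorphicOrderAt_comp_of_deriv_ne_zero ha1 hd1
  have o2 : meromorphicOrderAt (f ∘ checkPt s) y = _ :=
    meromorphicOrderAt_comp_of_deriv_ne_zero ha2 hd2
  have m1 : MeromorphicAt (f ∘ hatPt s) y := (hf _).comp_analyticAt ha1
  have m2 : MeromorphicAt (f ∘ checkPt s) y := (hf _).comp_analyticAt ha2
  have hne : (hatPt s - checkPt s) y ≠ 0 := by
    rw [← norm_pos_iff]
    exact zero_lt_one.trans_le hsub
  have m3 : MeromorphicAt (hatPt s - checkPt s)⁻¹ y := (ha1.sub ha2).meromorphicAt.inv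
  have o3 := order_inv_eq_zero_of_ne_zero (ha1.sub ha2) hne
  have e := awOp_eventuallyEq_nhds (s := s) f hy
  have mD : MeromorphicAt (awOp s f) y :=
    ((m1.add m2.neg).mul m3).congr (e.symm.filter_mono nhdsWithin_le_nhds)
  constructor
  · rw [meromorphicOrderAt_congr (e.filter_mono nhdsWithin_le_nhds),
      meromorphicOrderAt_mul (m1.add m2.neg) m3, o3, add_zero, ← o1, ← o2,
      meromorphicOrderAt_neg (f := f ∘ checkPt s)]
    exact meromorphicOrderAt_add m1 m2.neg
  · have n1 : ∀ᶠ x in 𝓝[≠] y, (f ∘ hatPt s) x ≠ 0 :=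
      (meromorphicOrderAt_ne_top_iff_eventually_ne_zero m1).1 (by rw [o1]; exact h0 _)
    have n2 : ∀ᶠ x in 𝓝[≠] y, (f ∘ checkPt s) x ≠ 0 :=
      (meromorphicOrderAt_ne_top_iff_eventually_ne_zero m2).1 (by rw [o2]; exact h0 _)
    have e2 : awOp s f⁻¹ =ᶠ[𝓝[≠] y] -awOp s f / ((f ∘ hatPt s) * (f ∘ checkPt s)) := by
      filter_upwards [n1, n2, e.filter_mono nhdsWithin_le_nhds,
        (awOp_eventuallyEq_nhds (s := s) f⁻¹ hy).filter_mono nhdsWithin_le_nhds] with x h1 h2 h3 h4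
      rw [h4]
      simp only [Pi.div_apply, Pi.neg_apply, Pi.mul_apply, Pi.add_apply, Pi.inv_apply,
        Function.comp_apply, Pi.sub_apply] at h1 h2 h3 ⊢
      rw [h3]
      field_simp
      ring
    rw [meromorphicOrderAt_congr e2, meromorphicOrderAt_div mD.neg (m1.mul m2),
      meromorphicOrderAt_mul m1 m2, o1, o2, ← meromorphicOrderAt_neg]

/-- The local form of the counting half. At most one value is taken at `y̌`, so the sum has at most
one nonzero term. For a finite value the zero of `D_q f` pays for it; for `∞` the quotient rule
does, with the two pole terms; if nothing is taken, the pole terms still dominate the possible poles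
of `D_q f`. -/
theorem eventually_sum_valueDivisor_le {s : ℂ} (hs : s ≠ 0) (hs1 : ‖s‖ < 1) {f : ℂ → ℂ}
    (hf : Meromorphic f) (hn : Nonconstant f) (hD : ∀ z, meromorphicOrderAt (awOp s f) z ≠ ⊤)
    (V : Finset (WithTop ℂ)) (hV : ∀ v ∈ V, IsAWPicardValue s f v) :
    ∀ᶠ y in cobounded ℂ, ∑ v ∈ V, valueDivisor f v (checkPt s y) ≤
      divisor (awOp s f) Set.univ y + valueDivisor f ⊤ (hatPt s y)
        + valueDivisor f ⊤ (checkPt s y) := by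
  have hpic : ∀ᶠ x in cobounded ℂ, ∀ v ∈ V, ((valueDivisor f v x).toNat : ℕ∞) ≤
      zeroMult (awOp s (differenceFunction f v)) (hatPt s x) := by
    rw [Filter.eventually_all_finset]
    intro v hv
    obtain ⟨R₀, h⟩ := (hV v hv).exists_zeroMult_le hf hn
    filter_upwards [eventually_cobounded_lt_norm R₀] with x hx using h x hx
  filter_upwards [eventually_order_awOp hs hs1 hf hn.order_ne_top,
    (tendsto_checkPt_cobounded hs).eventually hpic, eventually_hatPt_checkPt hs]
    with y ⟨h1, h2⟩ h3 h4
  rw [h4] at h3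
  obtain ⟨n₁, e1⟩ := WithTop.ne_top_iff_exists.1 (hn.order_ne_top (hatPt s y))
  obtain ⟨n₂, e2⟩ := WithTop.ne_top_iff_exists.1 (hn.order_ne_top (checkPt s y))
  obtain ⟨e, e3⟩ := WithTop.ne_top_iff_exists.1 (hD y)
  have hpole : ∀ (x : ℂ) (n : ℤ), n = meromorphicOrderAt f x → valueDivisor f ⊤ x = max (-n) 0 := by
    intro x n h
    change (divisor f Set.univ)⁻ x = _
    rw [Function.locallyFinsuppWithin.negPart_apply,
      divisor_apply hf.meromorphicOn (Set.mem_univ x), ← h]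
    rfl
  rw [divisor_apply (meromorphic_awOp hs hf).meromorphicOn (Set.mem_univ y), ← e3,
    hpole _ _ e1, hpole _ _ e2]
  rw [← e1, ← e2, ← e3] at h1 h2
  have h1' : min n₁ n₂ ≤ e := by exact_mod_cast h1
  have h2' : meromorphicOrderAt (awOp s f⁻¹) y = (e - (n₁ + n₂) : ℤ) := by
    rw [h2]; rfl
  change _ ≤ e + _ + _
  by_cases hz : ∀ v ∈ V, valueDivisor f v (checkPt s y) = 0
  · rw [Finset.sum_eq_zero hz]
    omega
  push Not at hz
  obtain ⟨v, hv, hvz⟩ := hz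
  have hv0 : 0 ≤ valueDivisor f v (checkPt s y) := valueDivisor_nonneg f v _
  have hvpos : 0 < valueDivisor f v (checkPt s y) := by omega
  rw [Finset.sum_eq_single_of_mem v hv
    (fun w _ hwv => valueDivisor_eq_zero_of_pos hf hn hwv.symm hvpos)]
  have h5 := h3 v hv
  cases v with
  | top =>
    change _ ≤ zeroMult (awOp s f⁻¹) y at h5
    rw [zeroMult_eq h2', Nat.cast_le] at h5
    rw [hpole _ _ e2] at h5 hvpos ⊢
    omega
  | coe a =>
    change _ ≤ zeroMult (awOp s f) y at h5
    rw [zeroMult_eq e3.symm, Nat.cast_le] at h5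
    omega

end AskeyWilson

namespace AskeyWilson

open Real Metric MeromorphicOn Bornology Function.locallyFinsuppWithin

/-! ### Comparison of logarithmic counting functions -/

/-- The weight of the point `z` in the logarithmic counting function at radius `r`. -/
noncomputable def countingWeight (r : ℝ) (z : ℂ) : ℝ := if z = 0 then log r else log⁺ (r * ‖z‖⁻¹)

theorem countingWeight_nonneg {r : ℝ} (hr : 1 ≤ r) (z : ℂ) : 0 ≤ countingWeight r z := by
  unfold countingWeight
  split_ifs
  · exact log_nonneg hr
  · exact posLog_nonneg

theorem countingWeight_mul_le {r K : ℝ} (hr : 0 < r) (hK : 1 ≤ K) (z : ℂ) :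
    countingWeight (K * r) z ≤ countingWeight r z + log K := by
  unfold countingWeight
  split_ifs
  · rw [log_mul (by positivity) (by positivity)]
    linarith
  · rw [mul_assoc, ← posLog_eq_log (x := K) (by rw [abs_of_pos] <;> linarith), add_comm]
    exact posLog_mul

theorem log_le_countingWeight_sq {ρ : ℝ} (hρ : 1 ≤ ρ) {z : ℂ} (hz : ‖z‖ ≤ ρ) :
    log ρ ≤ countingWeight (ρ ^ 2) z := by
  have hl : 0 ≤ log ρ := log_nonneg hρ
  unfold countingWeight
  split_ifs with h
  · rw [log_pow]
    push_cast
    linarith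
  · have hz0 : 0 < ‖z‖ := norm_pos_iff.2 h
    have h1 : ρ ≤ ρ ^ 2 * ‖z‖⁻¹ := by
      rw [← div_eq_mul_inv, le_div_iff₀ hz0, sq]
      gcongr
    exact (log_le_log (by linarith) h1).trans (le_max_right 0 _)

/-- With `log⁺` the weight vanishes outside the disc, so `F` may be larger than needed and one index
set serves two radii. -/
theorem logCounting_eq_sum_countingWeight (D : Function.locallyFinsupp ℂ ℤ) {r : ℝ} (hr : 0 < r)
    {F : Finset ℂ} (hF : closedBall (0 : ℂ) r ∩ D.support ⊆ F) :
    logCounting D r = ∑ z ∈ F, (D z : ℝ) * countingWeight r z := by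
  classical
  have h1 : ∀ z, ((toClosedBall r D z : ℤ) : ℝ) * log (r * ‖z‖⁻¹) =
      if z = 0 then 0 else (D z : ℝ) * log⁺ (r * ‖z‖⁻¹) := by
    intro z
    split_ifs with h
    · simp [h]
    have hz0 : 0 < ‖z‖ := norm_pos_iff.2 h
    by_cases hz : ‖z‖ ≤ r
    · rw [toClosedBall_eval_within D (by rw [mem_closedBall_zero_iff, abs_of_pos hr]; exact hz),
        posLog_eq_log]
      rw [abs_of_pos (by positivity), ← div_eq_mul_inv, one_le_div hz0]
      exact hz
    · have h2 : toClosedBall r D z = 0 := by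
        apply Function.locallyFinsuppWithin.apply_eq_zero_of_notMem
        rwa [mem_closedBall_zero_iff, abs_of_pos hr]
      have h3 : log⁺ (r * ‖z‖⁻¹) = 0 := by
        rw [posLog_eq_zero_iff, abs_of_pos (by positivity), ← div_eq_mul_inv, div_le_one hz0]
        linarith
      simp [h2, h3]
  have h2 : logCounting D r = ∑ᶠ z, ((toClosedBall r D z : ℤ) : ℝ) * log (r * ‖z‖⁻¹)
      + (D 0) * log r := rfl
  have hsub : (Function.support fun z => ((toClosedBall r D z : ℤ) : ℝ) * log (r * ‖z‖⁻¹))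
      ⊆ F := by
    intro z hz
    apply hF
    have h4 : toClosedBall r D z ≠ 0 := by
      intro h
      apply hz
      simp [h]
    have h3 : z ∈ closedBall (0 : ℂ) |r| := toClosedBall_support_subset_closedBall D h4
    refine ⟨by rwa [abs_of_pos hr] at h3, ?_⟩
    rwa [toClosedBall_eval_within D h3] at h4
  rw [h2, finsum_eq_sum_of_support_subset _ hsub]
  simp only [h1, countingWeight]
  by_cases h0 : (0 : ℂ) ∈ F
  · rw [← Finset.sum_erase_add F _ h0, ← Finset.sum_erase_add F _ h0, if_pos rfl, if_pos rfl,
      add_zero]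
    congr 1
    apply Finset.sum_congr rfl
    intro z hz
    rw [if_neg (Finset.ne_of_mem_erase hz), if_neg (Finset.ne_of_mem_erase hz)]
  · have hD0 : D 0 = 0 := by
      by_contra h
      exact h0 (hF ⟨by simp [hr.le], h⟩)
    rw [hD0, Int.cast_zero, zero_mul, add_zero]
    apply Finset.sum_congr rfl
    intro z hz
    have : z ≠ 0 := by
      rintro rfl
      exact h0 hz
    rw [if_neg this, if_neg this]

/-- The points of the support of `D` in the closed disc of radius `r`. -/
noncomputable def supportInDisc (D : Function.locallyFinsupp ℂ ℤ) (r : ℝ) : Finset ℂ :=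
  (finite_inter_support_locallyFinsupp D r).toFinset

theorem mem_supportInDisc {D : Function.locallyFinsupp ℂ ℤ} {r : ℝ} {z : ℂ} :
    z ∈ supportInDisc D r ↔ ‖z‖ ≤ r ∧ D z ≠ 0 := by
  simp [supportInDisc]

theorem logCounting_eq_sum_supportInDisc (D : Function.locallyFinsupp ℂ ℤ) {r R : ℝ} (hr : 0 < r)
    (hR : r ≤ R) : logCounting D r = ∑ z ∈ supportInDisc D R, (D z : ℝ) * countingWeight r z := by
  apply logCounting_eq_sum_countingWeight D hr
  rintro z ⟨hz, hz2⟩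
  rw [mem_closedBall_zero_iff] at hz
  exact mem_supportInDisc.2 ⟨hz.trans hR, hz2⟩

/-- Moving a point from `x` to `φ x` stretches its modulus by at most `K`, so enlarging the radius
by `K` does not decrease its weight. -/
theorem logCounting_le_of_injOn {D₁ D₂ : Function.locallyFinsupp ℂ ℤ} (h₁ : 0 ≤ D₁) (h₂ : 0 ≤ D₂)
    {φ : ℂ → ℂ} {K r : ℝ} (hK : 1 ≤ K) (hr : 1 ≤ r) (hinj : Set.InjOn φ D₁.support)
    (h0 : D₁ 0 = 0) (hφ : ∀ x, D₁ x ≠ 0 → φ x ≠ 0 ∧ ‖φ x‖ ≤ K * ‖x‖ ∧ D₁ x ≤ D₂ (φ x)) :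
    logCounting D₁ r ≤ logCounting D₂ (K * r) := by
  classical
  have hr0 : 0 < r := by linarith
  have hKr : 1 ≤ K * r := by nlinarith
  rw [logCounting_eq_sum_supportInDisc D₁ hr0 le_rfl,
    logCounting_eq_sum_supportInDisc D₂ (by linarith) le_rfl]
  calc ∑ z ∈ supportInDisc D₁ r, (D₁ z : ℝ) * countingWeight r z
      ≤ ∑ z ∈ supportInDisc D₁ r, (D₂ (φ z) : ℝ) * countingWeight (K * r) (φ z) := by
        apply Finset.sum_le_sum
        intro z hz
        obtain ⟨hzr, hzD⟩ := mem_supportInDisc.1 hz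
        obtain ⟨a1, a2, a3⟩ := hφ z hzD
        have hz0 : z ≠ 0 := by
          rintro rfl
          exact hzD h0
        have hzn : 0 < ‖z‖ := norm_pos_iff.2 hz0
        have hφn : 0 < ‖φ z‖ := norm_pos_iff.2 a1
        have b1 : (D₁ z : ℝ) ≤ D₂ (φ z) := by exact_mod_cast a3
        have b2 : countingWeight r z ≤ countingWeight (K * r) (φ z) := by
          rw [countingWeight, countingWeight, if_neg hz0, if_neg a1]
          apply posLog_le_posLog (by positivity)
          rw [← div_eq_mul_inv, ← div_eq_mul_inv, div_le_div_iff₀ hzn hφn]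
          nlinarith
        have b3 : (0 : ℝ) ≤ D₂ (φ z) := by exact_mod_cast h₂ (φ z)
        exact mul_le_mul b1 b2 (countingWeight_nonneg hr z) b3
    _ = ∑ z ∈ (supportInDisc D₁ r).image φ, (D₂ z : ℝ) * countingWeight (K * r) z := by
        rw [Finset.sum_image]
        intro a ha b hb hab
        exact hinj (mem_supportInDisc.1 ha).2 (mem_supportInDisc.1 hb).2 hab
    _ ≤ _ := by
        apply Finset.sum_le_sum_of_subset_of_nonneg
        · intro w hw
          obtain ⟨z, hz, rfl⟩ := Finset.mem_image.1 hw
          obtain ⟨hzr, hzD⟩ := mem_supportInDisc.1 hz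
          obtain ⟨a1, a2, a3⟩ := hφ z hzD
          refine mem_supportInDisc.2 ⟨a2.trans (by gcongr), ?_⟩
          have : 0 ≤ D₁ z := h₁ z
          omega
        · intro z _ _
          have b3 : (0 : ℝ) ≤ D₂ z := by exact_mod_cast h₂ z
          exact mul_nonneg b3 (countingWeight_nonneg hKr z)

/-- The pullback is locally finite because the growth bound sends bounded sets to bounded sets,
which meet the support of `D` in finitely many points, and `φ` is injective on `Y`. -/
theorem exists_pullback (D : Function.locallyFinsupp ℂ ℤ) {φ : ℂ → ℂ} {Y : Set ℂ} {K : ℝ}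
    (hK : 0 ≤ K) (hinj : Set.InjOn φ Y) (hφ : ∀ y ∈ Y, ‖φ y‖ ≤ K * ‖y‖) :
    ∃ D' : Function.locallyFinsupp ℂ ℤ, (∀ y ∈ Y, D' y = D (φ y)) ∧ ∀ y, y ∉ Y → D' y = 0 := by
  classical
  refine ⟨⟨fun y => if y ∈ Y then D (φ y) else 0, by simp, fun z _ => ⟨ball z 1,
    ball_mem_nhds z one_pos, ?_⟩⟩, fun y hy => if_pos hy, fun y hy => if_neg hy⟩
  have hmem : ∀ y ∈ (ball z 1 ∩ Function.support fun y => if y ∈ Y then D (φ y) else 0),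
      y ∈ Y ∧ φ y ∈ closedBall (0 : ℂ) (K * (‖z‖ + 1)) ∩ D.support := by
    rintro y ⟨hy, hy2⟩
    have hyY : y ∈ Y := by
      by_contra h
      exact hy2 (if_neg h)
    refine ⟨hyY, ?_, ?_⟩
    · rw [mem_closedBall_zero_iff]
      refine (hφ y hyY).trans ?_
      gcongr
      rw [mem_ball, dist_eq_norm] at hy
      have := norm_sub_norm_le y z
      linarith
    · simpa [hyY] using hy2
  refine Set.Finite.of_finite_image ((finite_inter_support_locallyFinsupp D (K * (‖z‖ + 1))).subset ?_)
    (hinj.mono fun y hy => (hmem y hy).1)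
  rintro _ ⟨y, hy, rfl⟩
  exact (hmem y hy).2

/-- The number of points of `D` in the closed disc of radius `r`. -/
noncomputable def countInDisc (D : Function.locallyFinsupp ℂ ℤ) (r : ℝ) : ℝ :=
  ∑ z ∈ supportInDisc D r, (D z : ℝ)

theorem logCounting_mul_le {D : Function.locallyFinsupp ℂ ℤ} (h : 0 ≤ D) {r K : ℝ} (hr : 0 < r)
    (hK : 1 ≤ K) : logCounting D (K * r) ≤ logCounting D r + countInDisc D (K * r) * log K := by
  rw [logCounting_eq_sum_supportInDisc D (by positivity) le_rfl,
    logCounting_eq_sum_supportInDisc D hr (show r ≤ K * r by nlinarith), countInDisc,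
    Finset.sum_mul, ← Finset.sum_add_distrib]
  apply Finset.sum_le_sum
  intro z _
  have b3 : (0 : ℝ) ≤ D z := by exact_mod_cast h z
  rw [← mul_add]
  exact mul_le_mul_of_nonneg_left (countingWeight_mul_le hr hK z) b3

/-- Each point of the disc of radius `ρ` has weight at least `log ρ` at radius `ρ ^ 2`. This is the
source of the gain `1 / log r`. -/
theorem countInDisc_mul_log_le {D : Function.locallyFinsupp ℂ ℤ} (h : 0 ≤ D) {ρ : ℝ}
    (hρ : 1 ≤ ρ) : countInDisc D ρ * log ρ ≤ logCounting D (ρ ^ 2) := by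
  have h1 : ρ ≤ ρ ^ 2 := by nlinarith
  rw [logCounting_eq_sum_supportInDisc D (by positivity) le_rfl, countInDisc, Finset.sum_mul]
  calc ∑ z ∈ supportInDisc D ρ, (D z : ℝ) * log ρ
      ≤ ∑ z ∈ supportInDisc D ρ, (D z : ℝ) * countingWeight (ρ ^ 2) z := by
        apply Finset.sum_le_sum
        intro z hz
        have b3 : (0 : ℝ) ≤ D z := by exact_mod_cast h z
        exact mul_le_mul_of_nonneg_left
          (log_le_countingWeight_sq hρ (mem_supportInDisc.1 hz).1) b3
    _ ≤ _ := by
        apply Finset.sum_le_sum_of_subset_of_nonneg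
        · intro z hz
          obtain ⟨a, b⟩ := mem_supportInDisc.1 hz
          exact mem_supportInDisc.2 ⟨a.trans h1, b⟩
        · intro z _ _
          have b3 : (0 : ℝ) ≤ D z := by exact_mod_cast h z
          exact mul_nonneg b3 (countingWeight_nonneg (by nlinarith) z)

theorem zeroPoleCount_mul_log_le {f : ℂ → ℂ} (hf : Meromorphic f) {ρ : ℝ} (hρ : 1 ≤ ρ) :
    zeroPoleCount f ρ * log ρ ≤ ValueDistribution.logCounting f 0 (ρ ^ 2)
      + ValueDistribution.logCounting f ⊤ (ρ ^ 2) := by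
  set D := divisor f Set.univ with hD
  have hA : 0 ≤ D⁺ + D⁻ := add_nonneg (posPart_nonneg _) (negPart_nonneg _)
  have habs : ∀ z, (D⁺ + D⁻) z = |D z| := by
    intro z
    rw [Function.locallyFinsuppWithin.coe_add, Pi.add_apply,
      Function.locallyFinsuppWithin.posPart_apply, Function.locallyFinsuppWithin.negPart_apply]
    exact posPart_add_negPart (D z)
  have hres : ∀ z ∈ closedBall (0 : ℂ) ρ, divisor f (closedBall 0 ρ) z = D z := by
    intro z hz
    rw [hD, divisor_apply hf.meromorphicOn hz, divisor_apply hf.meromorphicOn (Set.mem_univ z)]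
  have hcount : zeroPoleCount f ρ = countInDisc (D⁺ + D⁻) ρ := by
    rw [zeroPoleCount, countInDisc]
    apply Finset.sum_congr
    · ext z
      rw [mem_supportInDisc, habs, abs_ne_zero, Set.Finite.mem_toFinset]
      constructor
      · intro hz
        have hz2 : z ∈ closedBall (0 : ℂ) ρ :=
          (divisor f (closedBall 0 ρ)).supportWithinDomain hz
        refine ⟨by simpa using hz2, ?_⟩
        rw [← hres z hz2]
        exact hz
      · rintro ⟨h1, h2⟩
        rw [Function.mem_support, hres z (by simpa using h1)]
        exact h2
    · intro z hz
      rw [habs, hres z (by simpa using (mem_supportInDisc.1 hz).1)]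
      push_cast
      rfl
  rw [hcount, ValueDistribution.logCounting_zero, ValueDistribution.logCounting_top]
  refine (countInDisc_mul_log_le hA hρ).trans (le_of_eq ?_)
  rw [map_add]
  rfl

end AskeyWilson

/-! ### The counting half of the second main theorem -/

namespace AskeyWilson

open Real Metric MeromorphicOn Bornology Function.locallyFinsuppWithin

theorem exists_eventually_logCounting_le_of_support_subset {D : Function.locallyFinsupp ℂ ℤ}
    {B : ℝ} (h : ∀ x, B < ‖x‖ → D x = 0) :
    ∃ C : ℝ, ∀ᶠ r in atTop, |logCounting D r| ≤ C * log r := by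
  have hfin : D.support.Finite := by
    refine (finite_inter_support_locallyFinsupp D B).subset fun x hx => ⟨?_, hx⟩
    rw [mem_closedBall_zero_iff]
    by_contra hB
    exact hx (h x (not_le.1 hB))
  obtain ⟨C, hC⟩ := (logCounting_isBigO_log_of_finite_support hfin).bound
  refine ⟨C, ?_⟩
  filter_upwards [hC, eventually_ge_atTop 1] with r hr hr1
  rwa [Real.norm_eq_abs, Real.norm_eq_abs, abs_of_nonneg (log_nonneg hr1)] at hr

theorem exists_forall_of_eventually_cobounded {p : ℂ → Prop} (h : ∀ᶠ x in cobounded ℂ, p x) :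
    ∃ B : ℝ, ∀ x, B < ‖x‖ → p x := by
  obtain ⟨B, hB⟩ := (isBounded_def.2 (show {x | p x}ᶜᶜ ∈ cobounded ℂ by
    rw [compl_compl]; exact h)).subset_closedBall (0 : ℂ)
  refine ⟨B, fun x hx => ?_⟩
  by_contra hp
  have := hB hp
  rw [mem_closedBall_zero_iff] at this
  linarith

theorem exists_eventually_sum_logCounting_le {s : ℂ} (hs : s ≠ 0) (hs1 : ‖s‖ < 1) {f : ℂ → ℂ}
    (hf : Meromorphic f) (hn : Nonconstant f) (hD : ∀ z, meromorphicOrderAt (awOp s f) z ≠ ⊤)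
    (V : Finset (WithTop ℂ)) (hV : ∀ v ∈ V, IsAWPicardValue s f v) :
    ∃ C : ℝ, ∀ᶠ r in atTop, ∑ v ∈ V, ValueDistribution.logCounting f v r ≤
      logCounting (divisor (awOp s f) Set.univ) r
        + ValueDistribution.logCounting f ⊤ ((‖s‖⁻¹ + 1) * r)
        + ValueDistribution.logCounting f ⊤ r + C * log r := by
  set K : ℝ := ‖s‖⁻¹ + 1 with hK
  have hK1 : 1 ≤ K := by
    have : 0 ≤ ‖s‖⁻¹ := by positivity
    linarith
  set E := divisor (awOp s f) Set.univ with hE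
  set P := valueDivisor f ⊤ with hP
  have hP0 : 0 ≤ P := valueDivisor_nonneg f ⊤
  set S := ∑ v ∈ V, valueDivisor f v with hS
  have hSx : ∀ x, S x = ∑ v ∈ V, valueDivisor f v x := by
    intro x
    rw [hS, coe_sum, Finset.sum_apply]
  have hS0 : ∀ x, 0 ≤ S x := by
    intro x
    rw [hSx]
    exact Finset.sum_nonneg fun v _ => valueDivisor_nonneg f v x
  have hgood : ∀ᶠ y in cobounded ℂ, (S (checkPt s y) ≤ E y + P (hatPt s y) + P (checkPt s y)) ∧
      (‖hatPt s y‖ ≤ ‖y‖ ∧ ‖checkPt s y‖ ≤ K * ‖y‖) ∧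
      (checkPt s (hatPt s y) = y ∧ hatPt s (checkPt s y) = y) ∧
      0 < ‖y‖ ∧ 0 < ‖hatPt s y‖ ∧ 0 < ‖checkPt s y‖ := by
    filter_upwards [eventually_sum_valueDivisor_le hs hs1 hf hn hD V hV,
      eventually_norm_hatPt_le hs1, eventually_norm_checkPt_le s, eventually_checkPt_hatPt hs,
      eventually_hatPt_checkPt hs, eventually_cobounded_lt_norm 0,
      (tendsto_hatPt_cobounded hs).eventually (eventually_cobounded_lt_norm 0),
      (tendsto_checkPt_cobounded hs).eventually (eventually_cobounded_lt_norm 0)]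
      with y h1 h2 h3 h4 h5 h6 h7 h8
    rw [← hSx] at h1
    exact ⟨h1, ⟨h2, h3⟩, ⟨h4, h5⟩, h6, h7, h8⟩
  obtain ⟨R₁, hR₁⟩ := exists_forall_of_eventually_cobounded hgood
  set Y : Set ℂ := {y | R₁ < ‖y‖} with hY
  -- Beyond `R₂` both `x` and `x̂` lie in `Y`, so the pulled-back divisor can be evaluated at `x̂`.
  obtain ⟨R₂, hR₂⟩ := exists_forall_of_eventually_cobounded
    ((eventually_cobounded_lt_norm R₁).and
      ((tendsto_hatPt_cobounded hs).eventually (eventually_cobounded_lt_norm R₁)))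
  have hinjhat : Set.InjOn (hatPt s) Y := by
    intro a ha b hb hab
    rw [← (hR₁ a ha).2.2.1.1, ← (hR₁ b hb).2.2.1.1, hab]
  have hinjcheck : Set.InjOn (checkPt s) Y := by
    intro a ha b hb hab
    rw [← (hR₁ a ha).2.2.1.2, ← (hR₁ b hb).2.2.1.2, hab]
  have hK0 : 0 ≤ K := by linarith
  obtain ⟨S', hS'1, hS'2⟩ := exists_pullback S hK0 hinjcheck fun y hy => (hR₁ y hy).2.1.2
  obtain ⟨P₁, hP₁1, hP₁2⟩ := exists_pullback P (zero_le_one' ℝ) hinjhat fun y hy => by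
    rw [one_mul]; exact (hR₁ y hy).2.1.1
  obtain ⟨P₂, hP₂1, hP₂2⟩ := exists_pullback P hK0 hinjcheck fun y hy => (hR₁ y hy).2.1.2
  -- The part of `E` near the origin, where the local inequality is not available. It has finite
  -- support and costs only `O(log r)`, as does `S - Sout`.
  obtain ⟨Ein, hEin1, hEin2⟩ := exists_pullback E (zero_le_one' ℝ) (φ := id) (Y := Yᶜ)
    (fun a _ b _ hab => hab) fun y _ => by simp
  obtain ⟨Sout, hSout1, hSout2⟩ := exists_pullback S (zero_le_one' ℝ) (φ := id)
    (Y := {x | R₂ < ‖x‖}) (fun a _ b _ hab => hab) fun y _ => by simp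
  obtain ⟨C₁, hC₁⟩ := exists_eventually_logCounting_le_of_support_subset (D := Ein) (B := R₁)
    fun x hx => hEin2 x fun h => h hx
  obtain ⟨C₂, hC₂⟩ := exists_eventually_logCounting_le_of_support_subset (D := S - Sout) (B := R₂)
    fun x hx => by
      rw [coe_sub, Pi.sub_apply, hSout1 x hx]
      simp
  have hcmp : S' ≤ E - Ein + P₁ + P₂ := by
    intro y
    simp only [coe_add, coe_sub, Pi.add_apply, Pi.sub_apply]
    by_cases hy : y ∈ Y
    · rw [hS'1 y hy, hP₁1 y hy, hP₂1 y hy, hEin2 y (fun h => h hy), sub_zero]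
      exact (hR₁ y hy).1
    · rw [hS'2 y hy, hP₁2 y hy, hP₂2 y hy, hEin1 y hy]
      simp
  have hP₁0 : 0 ≤ P₁ := by
    intro y
    by_cases hy : y ∈ Y
    · rw [hP₁1 y hy]; exact hP0 _
    · rw [hP₁2 y hy]; rfl
  have hP₂0 : 0 ≤ P₂ := by
    intro y
    by_cases hy : y ∈ Y
    · rw [hP₂1 y hy]; exact hP0 _
    · rw [hP₂2 y hy]; rfl
  have hS'0 : 0 ≤ S' := by
    intro y
    by_cases hy : y ∈ Y
    · rw [hS'1 y hy]; exact hS0 _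
    · rw [hS'2 y hy]; rfl
  have hSout0 : 0 ≤ Sout := by
    intro y
    by_cases hy : R₂ < ‖y‖
    · rw [hSout1 y hy]; exact hS0 _
    · rw [hSout2 y hy]; rfl
  have mem_of {D' : Function.locallyFinsupp ℂ ℤ} {Z : Set ℂ} (h : ∀ y, y ∉ Z → D' y = 0) {y : ℂ}
      (hy : D' y ≠ 0) : y ∈ Z := by
    by_contra hyZ
    exact hy (h y hyZ)
  have h0Y : (0 : ℂ) ∉ Y := fun h => by simpa using (hR₁ 0 h).2.2.2.1
  have h0Z : ¬ R₂ < ‖(0 : ℂ)‖ := fun h => h0Y (hR₂ 0 h).1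
  refine ⟨C₁ + C₂, ?_⟩
  filter_upwards [hC₁, hC₂, eventually_ge_atTop 1] with r h1 h2 hr
  have a1 : logCounting P₁ r ≤ logCounting P (1 * r) := by
    refine logCounting_le_of_injOn hP₁0 hP0 le_rfl hr
      (hinjhat.mono fun y hy => mem_of hP₁2 hy) (hP₁2 0 h0Y) fun x hx => ?_
    have hxY := mem_of hP₁2 hx
    have := hR₁ x hxY
    exact ⟨norm_pos_iff.1 this.2.2.2.2.1, by rw [one_mul]; exact this.2.1.1, (hP₁1 x hxY).le⟩
  have a2 : logCounting P₂ r ≤ logCounting P (K * r) := by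
    refine logCounting_le_of_injOn hP₂0 hP0 hK1 hr
      (hinjcheck.mono fun y hy => mem_of hP₂2 hy) (hP₂2 0 h0Y) fun x hx => ?_
    have hxY := mem_of hP₂2 hx
    have := hR₁ x hxY
    exact ⟨norm_pos_iff.1 this.2.2.2.2.2, this.2.1.2, (hP₂1 x hxY).le⟩
  -- `S'` at `x̂` equals `S` at `x`, because the check shift undoes the hat shift; and `x̂` is no
  -- farther from the origin than `x`, so no radius is lost.
  have a3 : logCounting Sout r ≤ logCounting S' (1 * r) := by
    refine logCounting_le_of_injOn hSout0 hS'0 le_rfl hr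
      (hinjhat.mono fun y hy => (hR₂ y (mem_of hSout2 hy)).1) (hSout2 0 h0Z) fun x hx => ?_
    have hxZ := mem_of hSout2 hx
    obtain ⟨hxY, hhY⟩ := hR₂ x hxZ
    have := hR₁ x hxY
    refine ⟨norm_pos_iff.1 this.2.2.2.2.1, by rw [one_mul]; exact this.2.1.1, ?_⟩
    rw [hSout1 x hxZ, hS'1 _ hhY, this.2.2.1.1]
    rfl
  rw [one_mul] at a1 a3
  have a4 := logCounting_le hcmp hr
  rw [map_add, map_add, map_sub, Pi.add_apply, Pi.add_apply, Pi.sub_apply] at a4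
  rw [map_sub, Pi.sub_apply] at h2
  have e1 : ∑ v ∈ V, ValueDistribution.logCounting f v r = logCounting S r := by
    rw [hS, map_sum, Finset.sum_apply]
    simp only [logCounting_eq_logCounting_valueDivisor]
  rw [e1, logCounting_eq_logCounting_valueDivisor, ← hP]
  have b1 := neg_abs_le (logCounting Ein r)
  have b2 := le_abs_self (logCounting S r - logCounting Sout r)
  linarith

end AskeyWilson

namespace AskeyWilson

open Real Metric MeromorphicOn Bornology Function.locallyFinsuppWithin

/-! ### The proximity functions -/

/-- The logarithmic proximity of `w` to the value `v`. -/
noncomputable def valueProximity : WithTop ℂ → ℂ → ℝ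
  | ⊤, w => log⁺ ‖w‖
  | (a : ℂ), w => log⁺ ‖w - a‖⁻¹

theorem proximity_eq_circleAverage (f : ℂ → ℂ) (v : WithTop ℂ) (r : ℝ) :
    ValueDistribution.proximity f v r = circleAverage (fun x => valueProximity v (f x)) 0 r := by
  cases v with
  | top => rw [ValueDistribution.proximity_top]; rfl
  | coe a => rw [ValueDistribution.proximity_coe]; rfl

theorem circleIntegrable_valueProximity {f : ℂ → ℂ} (hf : Meromorphic f) (v : WithTop ℂ) (r : ℝ) :
    CircleIntegrable (fun x => valueProximity v (f x)) 0 r := by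
  cases v with
  | top => exact hf.meromorphicOn.circleIntegrable_posLog_norm
  | coe a =>
    have h : Meromorphic (fun x => f x - a)⁻¹ := (hf.fun_sub (fun _ => by fun_prop)).inv
    have := h.meromorphicOn.circleIntegrable_posLog_norm (c := 0) (R := r)
    simpa [valueProximity] using this

/-- The bound on `valueProximity v w` in terms of the finite value `a` closest to `w`. -/
noncomputable def proximityConst (a : ℂ) (v : WithTop ℂ) : ℝ :=
  log⁺ ‖a‖ + log 2 + log⁺ (2 / ‖v.untopD a - a‖)

theorem proximityConst_nonneg (a : ℂ) (v : WithTop ℂ) : 0 ≤ proximityConst a v := by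
  have h1 := posLog_nonneg (x := ‖a‖)
  have h2 := posLog_nonneg (x := 2 / ‖v.untopD a - a‖)
  have h3 := log_nonneg (one_le_two (α := ℝ))
  unfold proximityConst
  linarith

/-- If `a` is the nearest finite value, any other `b` satisfies `‖w - b‖ ≥ ‖b - a‖ / 2`, so only `a`
and `⊤` give unbounded contributions. For these two values the last summand of `proximityConst` is
`log⁺ (2 / 0) = 0`. -/
theorem valueProximity_le {a w : ℂ} (v : WithTop ℂ)
    (h : ∀ b : ℂ, (b : WithTop ℂ) = v → ‖w - a‖ ≤ ‖w - b‖) :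
    valueProximity v w ≤ (if v = ⊤ then log⁺ ‖w‖ else 0)
      + (if v = a then log⁺ ‖w‖ - log ‖w - a‖ else 0) + proximityConst a v := by
  have h1 := posLog_nonneg (x := ‖a‖)
  have h3 := log_nonneg (one_le_two (α := ℝ))
  cases v with
  | top =>
    simp only [valueProximity, if_true, WithTop.top_ne_coe, if_false]
    linarith [proximityConst_nonneg a ⊤]
  | coe b =>
    have h2 := posLog_nonneg (x := 2 / ‖(b : WithTop ℂ).untopD a - a‖)
    simp only [valueProximity, WithTop.coe_ne_top, if_false, WithTop.coe_inj]
    by_cases hba : b = a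
    · subst hba
      simp only [if_true]
      have e := posLog_sub_posLog_inv (x := ‖w - b‖)
      have : log⁺ ‖w - b‖ ≤ log 2 + log⁺ ‖w‖ + log⁺ ‖b‖ :=
        (posLog_le_posLog (norm_nonneg _) (norm_sub_le w b)).trans posLog_add
      unfold proximityConst
      linarith
    · simp only [hba, if_false, zero_add]
      have hpos : 0 < ‖b - a‖ := norm_pos_iff.2 (sub_ne_zero.2 hba)
      have h4 : ‖b - a‖ / 2 ≤ ‖w - b‖ := by
        have h5 : ‖b - a‖ ≤ ‖w - a‖ + ‖w - b‖ := by
          calc ‖b - a‖ = ‖(w - a) - (w - b)‖ := by ring_nf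
            _ ≤ _ := norm_sub_le _ _
        linarith [h b rfl]
      have h6 : log⁺ ‖w - b‖⁻¹ ≤ log⁺ (2 / ‖b - a‖) := by
        apply posLog_le_posLog (by positivity)
        rw [← inv_div]
        exact inv_anti₀ (by positivity) h4
      have : (b : WithTop ℂ).untopD a = b := rfl
      unfold proximityConst
      rw [this]
      linarith

/-- The nearest value `a` and the value `⊤` each contribute one `log⁺ ‖w‖`, and the term `-log ‖w -
a‖` cancels. The coefficient `2` is what three values have to beat. -/
theorem exists_log_norm_sub_add_sum_valueProximity_le (V : Finset (WithTop ℂ)) (A : Finset ℂ)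
    (hA : A.Nonempty) (hAV : ∀ a : ℂ, a ∈ A ↔ (a : WithTop ℂ) ∈ V) :
    ∃ C : ℝ, ∀ w : ℂ, ∃ a ∈ A,
      log ‖w - a‖ + ∑ v ∈ V, valueProximity v w ≤ 2 * log⁺ ‖w‖ + C := by
  refine ⟨∑ a ∈ A, ∑ v ∈ V, proximityConst a v, fun w => ?_⟩
  obtain ⟨a, ha, hmin⟩ := A.exists_min_image (fun a => ‖w - a‖) hA
  refine ⟨a, ha, ?_⟩
  have h1 : ∑ v ∈ V, valueProximity v w ≤ ∑ v ∈ V, ((if v = ⊤ then log⁺ ‖w‖ else 0)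
      + (if v = a then log⁺ ‖w‖ - log ‖w - a‖ else 0) + proximityConst a v) := by
    refine Finset.sum_le_sum fun v hv => valueProximity_le v fun b hb => hmin b ?_
    rw [hAV, hb]
    exact hv
  rw [Finset.sum_add_distrib, Finset.sum_add_distrib, Finset.sum_ite_eq', Finset.sum_ite_eq',
    if_pos ((hAV a).1 ha)] at h1
  have h2 : ∑ v ∈ V, proximityConst a v ≤ ∑ a ∈ A, ∑ v ∈ V, proximityConst a v :=
    Finset.single_le_sum (f := fun a => ∑ v ∈ V, proximityConst a v)
      (fun b _ => Finset.sum_nonneg fun v _ => proximityConst_nonneg b v) ha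
  have h3 : (if (⊤ : WithTop ℂ) ∈ V then log⁺ ‖w‖ else 0) ≤ log⁺ ‖w‖ := by
    split_ifs
    · exact le_rfl
    · exact posLog_nonneg
  linarith

theorem log_norm_sub_div_le {u v w d : ℂ} (hu : u ≠ 0) (hv : v ≠ 0)
    (hd : 1 ≤ ‖d‖) (huv : u ≠ v) :
    log ‖(u - v) / d‖ ≤ log 2 + log ‖w‖ +
      (|log ‖u‖ - log ‖w‖| + |log ‖v‖ - log ‖w‖|) := by
  set M := log ‖w‖ + (|log ‖u‖ - log ‖w‖| + |log ‖v‖ - log ‖w‖|) with hM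
  have bu : ‖u‖ ≤ exp M := by
    rw [← log_le_iff_le_exp (norm_pos_iff.2 hu), hM]
    linarith [le_abs_self (log ‖u‖ - log ‖w‖), abs_nonneg (log ‖v‖ - log ‖w‖)]
  have bv : ‖v‖ ≤ exp M := by
    rw [← log_le_iff_le_exp (norm_pos_iff.2 hv), hM]
    linarith [le_abs_self (log ‖v‖ - log ‖w‖), abs_nonneg (log ‖u‖ - log ‖w‖)]
  have h1 : ‖(u - v) / d‖ ≤ 2 * exp M := by
    rw [norm_div]
    refine (div_le_self (norm_nonneg _) hd).trans ((norm_sub_le _ _).trans ?_)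
    linarith
  have hd0 : d ≠ 0 := norm_pos_iff.1 (by linarith)
  have h2 := log_le_log (norm_pos_iff.2 (div_ne_zero (sub_ne_zero.2 huv) hd0)) h1
  rw [log_mul two_ne_zero (exp_pos M).ne', log_exp, hM] at h2
  linarith

/-- The mean over the circle of radius `r` of the logarithmic increment of `f - a` along `y`. -/
noncomputable def meanIncrement (f y : ℂ → ℂ) (a : ℂ) (r : ℝ) : ℝ :=
  circleAverage (fun x => |log ‖f (y x) - a‖ - log ‖f x - a‖|) 0 r

theorem meromorphic_sub_const {f : ℂ → ℂ} (hf : Meromorphic f) (a : ℂ) :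
    Meromorphic fun x => f x - a :=
  hf.fun_sub (fun _ => by fun_prop)

theorem exists_eventually_circleAverage_log_norm_awOp_le {s : ℂ} (hs : s ≠ 0) (hs1 : ‖s‖ < 1)
    {f : ℂ → ℂ} (hf : Meromorphic f) (hn : Nonconstant f)
    (hD : ∀ z, meromorphicOrderAt (awOp s f) z ≠ ⊤) (V : Finset (WithTop ℂ)) (A : Finset ℂ)
    (hA : A.Nonempty) (hAV : ∀ a : ℂ, a ∈ A ↔ (a : WithTop ℂ) ∈ V) :
    ∃ C : ℝ, ∀ᶠ r in atTop, circleAverage (fun x => log ‖awOp s f x‖) 0 r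
        + ∑ v ∈ V, ValueDistribution.proximity f v r ≤
      2 * ValueDistribution.proximity f ⊤ r + C
        + ∑ a ∈ A, (meanIncrement f (hatPt s) a r + meanIncrement f (checkPt s) a r) := by
  obtain ⟨C, hC⟩ := exists_log_norm_sub_add_sum_valueProximity_le V A hA hAV
  obtain ⟨B, hB⟩ := exists_forall_of_eventually_cobounded
    ((eventually_one_le_norm_hatPt_sub_checkPt hs hs1).and
      ((eventually_deriv_hatPt_ne_zero hs).and (eventually_deriv_checkPt_ne_zero hs)))
  refine ⟨C + log 2, ?_⟩
  filter_upwards [eventually_gt_atTop (max B 1)] with r hr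
  have hrB : B < r := (le_max_left _ _).trans_lt hr
  have hr1 : 1 < r := (le_max_right _ _).trans_lt hr
  have hr0 : r ≠ 0 := by linarith
  have hnorm : ∀ x ∈ sphere (0 : ℂ) |r|, ‖x‖ = r := by
    intro x hx
    rwa [mem_sphere_zero_iff_norm, abs_of_pos (by linarith)] at hx
  have hhat : AnalyticOnNhd ℂ (hatPt s) (sphere 0 |r|) := fun x hx =>
    analyticAt_hatPt s (by rw [hnorm x hx]; exact hr1)
  have hchk : AnalyticOnNhd ℂ (checkPt s) (sphere 0 |r|) := fun x hx =>
    analyticAt_checkPt s (by rw [hnorm x hx]; exact hr1)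
  have hhatc : ∀ x ∈ sphere (0 : ℂ) |r|, ¬ EventuallyConst (hatPt s) (𝓝 x) := fun x hx =>
    not_eventuallyConst_of_deriv_ne_zero (hB x (by rw [hnorm x hx]; exact hrB)).2.1
  have hchkc : ∀ x ∈ sphere (0 : ℂ) |r|, ¬ EventuallyConst (checkPt s) (𝓝 x) := fun x hx =>
    not_eventuallyConst_of_deriv_ne_zero (hB x (by rw [hnorm x hx]; exact hrB)).2.2
  have hmD := meromorphic_awOp hs hf
  have hne (a : ℂ) (U : Set ℂ) : ∀ᶠ x in codiscreteWithin U, f x - a ≠ 0 :=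
    (meromorphic_sub_const hf a).meromorphicOn.eventually_codiscreteWithin_apply_ne_zero
      fun z _ => hn a z
  have iD : CircleIntegrable (fun x => log ‖awOp s f x‖) 0 r :=
    hmD.meromorphicOn.circleIntegrable_log_norm
  have iV := circleIntegrable_valueProximity hf (r := r)
  have iVs : CircleIntegrable (fun x => ∑ v ∈ V, valueProximity v (f x)) 0 r :=
    CircleIntegrable.fun_sum V fun v _ => iV v
  have ih (a : ℂ) := circleIntegrable_abs_log_increment (meromorphic_sub_const hf a) hhat
  have ic (a : ℂ) := circleIntegrable_abs_log_increment (meromorphic_sub_const hf a) hchk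
  have ihc (a : ℂ) : CircleIntegrable (fun x => |log ‖f (hatPt s x) - a‖ - log ‖f x - a‖| +
      |log ‖f (checkPt s x) - a‖ - log ‖f x - a‖|) 0 r := (ih a).add (ic a)
  have iA : CircleIntegrable (fun x => ∑ a ∈ A,
      (|log ‖f (hatPt s x) - a‖ - log ‖f x - a‖| + |log ‖f (checkPt s x) - a‖ - log ‖f x - a‖|))
      0 r := CircleIntegrable.fun_sum A fun a _ => ihc a
  have iT : CircleIntegrable (fun x => 2 * valueProximity ⊤ (f x)) 0 r := (iV ⊤).const_mul _
  have i0 : CircleIntegrable (fun _ => C + log 2) (0 : ℂ) r := circleIntegrable_const _ _ _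
  have iT0 : CircleIntegrable (fun x => 2 * valueProximity ⊤ (f x) + (C + log 2)) 0 r := iT.add i0
  have key : circleAverage (fun x => log ‖awOp s f x‖ + ∑ v ∈ V, valueProximity v (f x)) 0 r ≤
      circleAverage (fun x => 2 * valueProximity ⊤ (f x) + (C + log 2) + ∑ a ∈ A,
        (|log ‖f (hatPt s x) - a‖ - log ‖f x - a‖| +
          |log ‖f (checkPt s x) - a‖ - log ‖f x - a‖|)) 0 r := by
    apply circleAverage_mono_codiscreteWithin hr0 (iD.add iVs) (iT0.add iA)
    have e2 : ∀ᶠ x in codiscreteWithin (sphere (0 : ℂ) |r|), ∀ a ∈ A, f (hatPt s x) - a ≠ 0 :=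
      (Finset.eventually_all A).2 fun a _ => hhat.preimage_mem_codiscreteWithin hhatc (hne a _)
    have e3 : ∀ᶠ x in codiscreteWithin (sphere (0 : ℂ) |r|), ∀ a ∈ A, f (checkPt s x) - a ≠ 0 :=
      (Finset.eventually_all A).2 fun a _ => hchk.preimage_mem_codiscreteWithin hchkc (hne a _)
    have e4 : ∀ᶠ x in codiscreteWithin (sphere (0 : ℂ) |r|), awOp s f x ≠ 0 :=
      hmD.meromorphicOn.eventually_codiscreteWithin_apply_ne_zero fun z _ => hD z
    filter_upwards [e2, e3, e4, self_mem_codiscreteWithin _] with x h2 h3 h4 hx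
    simp only [Pi.add_apply]
    obtain ⟨a, ha, hle⟩ := hC (f x)
    have hxr := hnorm x hx
    have hx1 : x ≠ 1 := by rintro rfl; simp at hxr; linarith
    have hx2 : x ≠ -1 := by rintro rfl; simp at hxr; linarith
    rw [awOp_eq hx1 hx2] at h4 ⊢
    have huv : f (hatPt s x) - a ≠ f (checkPt s x) - a := by
      intro h
      rw [sub_left_inj] at h
      simp [h] at h4
    have h5 := log_norm_sub_div_le (h2 a ha) (h3 a ha) (w := f x - a)
      (hB x (by rw [hxr]; exact hrB)).1 huv
    rw [sub_sub_sub_cancel_right] at h5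
    -- The nearest value `a` varies with `x`; summing the increments over all of `A` gives a bound
    -- that can be averaged.
    have h6 := Finset.single_le_sum (f := fun a => |log ‖f (hatPt s x) - a‖ - log ‖f x - a‖| +
      |log ‖f (checkPt s x) - a‖ - log ‖f x - a‖|) (s := A) (fun b _ => by positivity) ha
    have h7 : valueProximity ⊤ (f x) = log⁺ ‖f x‖ := rfl
    rw [h7]
    linarith
  rw [circleAverage_fun_add iD iVs, circleAverage_fun_sum fun v _ => iV v,
    circleAverage_fun_add iT0 iA, circleAverage_fun_add iT i0, circleAverage_const,
    circleAverage_fun_sum fun a _ => ihc a] at key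
  have e5 := circleAverage_fun_smul (a := (2 : ℝ)) (f := fun x => valueProximity ⊤ (f x))
    (c := 0) (R := r)
  simp only [smul_eq_mul] at e5
  have e6 : ∀ a ∈ A, circleAverage (fun x => |log ‖f (hatPt s x) - a‖ - log ‖f x - a‖| +
      |log ‖f (checkPt s x) - a‖ - log ‖f x - a‖|) 0 r =
      meanIncrement f (hatPt s) a r + meanIncrement f (checkPt s) a r := fun a _ =>
    circleAverage_fun_add (ih a) (ic a)
  simp only [proximity_eq_circleAverage]
  rw [e5, Finset.sum_congr rfl e6] at key
  exact key

end AskeyWilson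

namespace AskeyWilson

open Real Metric MeromorphicOn Bornology Function.locallyFinsuppWithin
open ValueDistribution (characteristic proximity)

/-! ### The second main theorem for the Askey-Wilson operator -/

theorem characteristic_coe_eq (f : ℂ → ℂ) (a : ℂ) :
    characteristic f a = characteristic (fun x => f x - a)⁻¹ ⊤ := by
  unfold characteristic
  rw [ValueDistribution.proximity_coe_eq_proximity_sub_const_zero,
    ValueDistribution.logCounting_coe_eq_logCounting_sub_const_zero,
    ValueDistribution.proximity_inv, ValueDistribution.logCounting_inv]
  rfl

theorem exists_abs_characteristic_sub_le {f : ℂ → ℂ} (hf : Meromorphic f) (v : WithTop ℂ) :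
    ∃ C : ℝ, ∀ r, |characteristic f ⊤ r - characteristic f v r| ≤ C := by
  cases v with
  | top => exact ⟨0, fun r => by simp⟩
  | coe a =>
    refine ⟨log⁺ ‖a‖ + log 2 + max |log ‖f 0 - a‖|
      |log ‖meromorphicTrailingCoeffAt (fun x => f x - a) 0‖|, fun r => ?_⟩
    rw [characteristic_coe_eq]
    have h1 := ValueDistribution.abs_characteristic_sub_characteristic_shift_le (r := r)
      (a₀ := a) hf
    have h2 := ValueDistribution.characteristic_sub_characteristic_inv_le (R := r)
      (meromorphic_sub_const hf a)
    exact (abs_sub_le _ _ _).trans (add_le_add h1 h2)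

theorem exists_eventually_meanIncrement_le {f : ℂ → ℂ} (hf : Meromorphic f) (hn : Nonconstant f)
    (a : ℂ) {y : ℂ → ℂ} {K A : ℝ} (hK : 1 ≤ K) (hy : ∀ᶠ r in atTop,
      AnalyticOnNhd ℂ y (sphere 0 |r|) ∧ (∀ x ∈ sphere (0 : ℂ) |r|, ¬ EventuallyConst y (𝓝 x)) ∧
      (∀ x ∈ sphere (0 : ℂ) |r|, ‖y x‖ ≤ K * r) ∧
      ∀ u, circleAverage (fun x => |log ‖y x - u‖ - log ‖x - u‖|) 0 r ≤ A) :
    ∃ C : ℝ, 0 ≤ C ∧ ∀ᶠ r in atTop,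
      meanIncrement f y a r ≤ C * ((1 + characteristic f ⊤ (r ^ 4)) / log r) := by
  obtain ⟨c₁, h₁⟩ := exists_abs_characteristic_sub_le hf a
  set g : ℂ → ℂ := fun x => f x - a with hg
  have hgm : Meromorphic g := meromorphic_sub_const hf a
  obtain ⟨c, hc⟩ : ∃ c : ℝ, 0 ≤ c ∧ ∀ r, characteristic g ⊤ r ≤ characteristic f ⊤ r + c ∧
      characteristic g⁻¹ ⊤ r ≤ characteristic f ⊤ r + c := by
    refine ⟨max 0 (max (log⁺ ‖a‖ + log 2) c₁), le_max_left _ _, fun r => ⟨?_, ?_⟩⟩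
    · have h1 := ValueDistribution.abs_characteristic_sub_characteristic_shift_le (r := r)
        (a₀ := a) hf
      have h2 := (abs_le.1 h1).1
      have h3 : log⁺ ‖a‖ + log 2 ≤ max 0 (max (log⁺ ‖a‖ + log 2) c₁) :=
        (le_max_left _ _).trans (le_max_right _ _)
      linarith
    · have h1 := h₁ r
      rw [characteristic_coe_eq] at h1
      have h2 := (abs_le.1 h1).1
      have h3 : c₁ ≤ max 0 (max (log⁺ ‖a‖ + log 2) c₁) :=
        (le_max_right _ _).trans (le_max_right _ _)
      linarith
  obtain ⟨hc0, hc⟩ := hc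
  refine ⟨2 * (1 + c) * (|A| / 2 + 64 * K), by positivity, ?_⟩
  filter_upwards [hy, eventually_ge_atTop (max 2 (2 * K))] with r ⟨hy1, hy2, hy3, hy4⟩ hr
  have hr2 : 2 ≤ r := (le_max_left _ _).trans hr
  have hrK : 2 * K ≤ r := (le_max_right _ _).trans hr
  have hr0 : 0 < r := by linarith
  have hR : 1 ≤ r ^ 2 := by nlinarith
  have hL : 0 < log r := log_pos (by linarith)
  have hR4 : r ^ 2 ≤ r ^ 4 := pow_le_pow_right₀ (by linarith) (by norm_num)
  -- Radius `r ^ 2` balances the two errors: the harmonic part becomes `O(Q / r)`, while the zeros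
  -- and poles up to `r ^ 2` number at most `Q / (2 log r)`, measured at radius `r ^ 4`.
  have main := circleAverage_abs_log_increment_le hgm (fun z => hn a z) hr0 hR hK
    (by nlinarith) hy1 hy2 hy3 hy4
  set T := characteristic f ⊤ (r ^ 4) with hT
  have hT0 : 0 ≤ T := ValueDistribution.characteristic_nonneg (hR.trans hR4)
  set Q := 2 * (T + c) with hQ
  have hQ0 : 0 ≤ Q := by positivity
  have pos4 : (1 : ℝ) ≤ r ^ 4 := hR.trans hR4
  have hn1 : zeroPoleCount g (r ^ 2) * (2 * log r) ≤ Q := by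
    have h1 := zeroPoleCount_mul_log_le hgm hR
    rw [← pow_mul, log_pow] at h1
    have h2 : ValueDistribution.logCounting g 0 (r ^ 4) ≤ characteristic g⁻¹ ⊤ (r ^ 4) := by
      rw [← ValueDistribution.logCounting_inv]
      exact le_add_of_nonneg_left (ValueDistribution.proximity_nonneg _)
    have h3 : ValueDistribution.logCounting g ⊤ (r ^ 4) ≤ characteristic g ⊤ (r ^ 4) :=
      le_add_of_nonneg_left (ValueDistribution.proximity_nonneg _)
    have h4 := hc (r ^ 4)
    norm_num at h1
    linarith
  have hav : circleAverage (fun z => |log ‖g z‖|) 0 (r ^ 2) ≤ Q := by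
    rw [circleAverage_abs_log_norm_eq hgm]
    have h2 : proximity g ⊤ (r ^ 2) ≤ characteristic g ⊤ (r ^ 2) :=
      le_add_of_nonneg_right (ValueDistribution.logCounting_nonneg hR)
    have h3 : proximity g⁻¹ ⊤ (r ^ 2) ≤ characteristic g⁻¹ ⊤ (r ^ 2) :=
      le_add_of_nonneg_right (ValueDistribution.logCounting_nonneg hR)
    have h4 := hc (r ^ 2)
    have h5 : characteristic f ⊤ (r ^ 2) ≤ T :=
      ValueDistribution.characteristic_monotoneOn hf (Set.mem_Ioi.2 (by linarith))
        (Set.mem_Ioi.2 (by linarith)) hR4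
    linarith
  have hn0 : 0 ≤ zeroPoleCount g (r ^ 2) := Finset.sum_nonneg fun _ _ => abs_nonneg _
  have hlog : log (2 * r ^ 2) ≤ 3 * log r := by
    rw [log_mul two_ne_zero (by positivity), log_pow]
    have := log_le_log two_pos hr2
    push_cast
    linarith
  set n := zeroPoleCount g (r ^ 2) with hn'
  have hnQ : n ≤ Q / (2 * log r) := by rwa [le_div_iff₀ (by positivity)]
  have t1 : n * A ≤ Q / log r * (|A| / 2) := by
    calc n * A ≤ n * |A| := by gcongr; exact le_abs_self A
      _ ≤ Q / (2 * log r) * |A| := by gcongr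
      _ = _ := by field_simp
  have t2 : n * (2 * log (2 * r ^ 2)) ≤ 3 * Q := by
    calc n * (2 * log (2 * r ^ 2)) ≤ n * (2 * (3 * log r)) := by gcongr
      _ ≤ 3 * Q := by linarith
  have t3 : 8 * (2 * K * r) / r ^ 2 * (circleAverage (fun z => |log ‖g z‖|) 0 (r ^ 2)
      + n * (2 * log (2 * r ^ 2))) ≤ Q / log r * (64 * K) := by
    calc _ ≤ 8 * (2 * K * r) / r ^ 2 * (Q + 3 * Q) := by gcongr
      _ = Q / r * (64 * K) := by field_simp; ring
      _ ≤ Q / log r * (64 * K) := by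
        gcongr
        linarith [log_le_sub_one_of_pos hr0]
  have t4 : Q / log r ≤ 2 * (1 + c) * ((1 + T) / log r) := by
    rw [← mul_div_assoc]
    gcongr
    nlinarith
  calc meanIncrement f y a r ≤ Q / log r * (|A| / 2) + Q / log r * (64 * K) :=
        main.trans (add_le_add t1 t3)
    _ = Q / log r * (|A| / 2 + 64 * K) := by ring
    _ ≤ 2 * (1 + c) * ((1 + T) / log r) * (|A| / 2 + 64 * K) := by gcongr
    _ = _ := by ring

theorem exists_eventually_logCounting_top_mul_le {f : ℂ → ℂ} {K : ℝ} (hK : 1 ≤ K) :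
    ∀ᶠ r in atTop, ValueDistribution.logCounting f ⊤ (K * r) ≤
      ValueDistribution.logCounting f ⊤ r + log K * (characteristic f ⊤ (r ^ 4) / log r) := by
  filter_upwards [eventually_ge_atTop (max 2 K)] with r hr
  have hr2 : 2 ≤ r := (le_max_left _ _).trans hr
  have hrK : K ≤ r := (le_max_right _ _).trans hr
  have hL : 0 < log r := log_pos (by linarith)
  have hKr : r ≤ K * r := le_mul_of_one_le_left (by linarith) hK
  have hpos := valueDivisor_nonneg f ⊤
  have h1 := logCounting_mul_le hpos (r := r) (by linarith) hK
  have h2 := countInDisc_mul_log_le hpos (ρ := K * r) (by linarith)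
  simp only [logCounting_eq_logCounting_valueDivisor]
  have h3 : logCounting (valueDivisor f ⊤) ((K * r) ^ 2) ≤ characteristic f ⊤ (r ^ 4) := by
    rw [← logCounting_eq_logCounting_valueDivisor]
    refine (ValueDistribution.logCounting_monotoneOn (Set.mem_Ioi.2 (by positivity))
      (Set.mem_Ioi.2 (by positivity)) (?_ : _ ≤ r ^ 4)).trans
      (le_add_of_nonneg_left (ValueDistribution.proximity_nonneg _))
    calc (K * r) ^ 2 ≤ (r * r) ^ 2 := by gcongr
      _ = r ^ 4 := by ring
  have h4 : 0 ≤ countInDisc (valueDivisor f ⊤) (K * r) :=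
    Finset.sum_nonneg fun z _ => by exact_mod_cast hpos z
  have h5 : countInDisc (valueDivisor f ⊤) (K * r) ≤ characteristic f ⊤ (r ^ 4) / log r := by
    rw [le_div_iff₀ hL]
    refine (mul_le_mul_of_nonneg_left (log_le_log (by linarith) hKr) h4).trans (h2.trans h3)
  have := mul_le_mul_of_nonneg_right h5 (log_nonneg hK)
  linarith

theorem exists_eventually_meanIncrement_hatPt_checkPt_le {s : ℂ} (hs : s ≠ 0) (hs1 : ‖s‖ < 1)
    {f : ℂ → ℂ} (hf : Meromorphic f) (hn : Nonconstant f) (a : ℂ) :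
    ∃ C : ℝ, 0 ≤ C ∧ ∀ᶠ r in atTop, meanIncrement f (hatPt s) a r + meanIncrement f (checkPt s) a r
      ≤ C * ((1 + characteristic f ⊤ (r ^ 4)) / log r) := by
  set K : ℝ := ‖s‖⁻¹ + 1 with hK
  have hK1 : 1 ≤ K := by
    have : 0 ≤ ‖s‖⁻¹ := by positivity
    linarith
  obtain ⟨B, hB⟩ := exists_forall_of_eventually_cobounded
    (((eventually_norm_hatPt_le hs1).and (eventually_norm_checkPt_le s)).and
      ((eventually_deriv_hatPt_ne_zero hs).and (eventually_deriv_checkPt_ne_zero hs)))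
  have hnorm {r : ℝ} (hr : 0 < r) : ∀ x ∈ sphere (0 : ℂ) |r|, ‖x‖ = r := by
    intro x hx
    rwa [mem_sphere_zero_iff_norm, abs_of_pos hr] at hx
  have hev : ∀ᶠ r : ℝ in atTop, B < r ∧ 1 < r ∧ ‖(s - s⁻¹) ^ 2 / 4‖ ≤ r ^ 2 := by
    filter_upwards [eventually_gt_atTop B, eventually_gt_atTop 1,
      eventually_ge_atTop ‖(s - s⁻¹) ^ 2 / 4‖] with r h1 h2 h3
    exact ⟨h1, h2, h3.trans (by nlinarith)⟩
  have bound : ∀ᶠ r : ℝ in atTop, (AnalyticOnNhd ℂ (hatPt s) (sphere 0 |r|) ∧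
      AnalyticOnNhd ℂ (checkPt s) (sphere 0 |r|)) ∧ (∀ x ∈ sphere (0 : ℂ) |r|,
      ¬ EventuallyConst (hatPt s) (𝓝 x) ∧ ¬ EventuallyConst (checkPt s) (𝓝 x) ∧
      ‖hatPt s x‖ ≤ K * r ∧ ‖checkPt s x‖ ≤ K * r) := by
    filter_upwards [hev] with r ⟨hrB, hr1, hβ⟩
    have hnr := hnorm (r := r) (by linarith)
    refine ⟨⟨fun x hx => analyticAt_hatPt s (by rw [hnr x hx]; exact hr1), fun x hx =>
      analyticAt_checkPt s (by rw [hnr x hx]; exact hr1)⟩, fun x hx => ?_⟩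
    have hxr := hnr x hx
    obtain ⟨⟨h1, h2⟩, h3, h4⟩ := hB x (by rw [hxr]; exact hrB)
    rw [hxr] at h1 h2
    exact ⟨not_eventuallyConst_of_deriv_ne_zero h3, not_eventuallyConst_of_deriv_ne_zero h4,
      h1.trans (by nlinarith), h2⟩
  obtain ⟨C₁, hC₁, h₁⟩ := exists_eventually_meanIncrement_le hf hn a (y := hatPt s)
    (A := 4 * log 2 + 3 * log⁺ K) hK1 (by
      filter_upwards [hev, bound] with r ⟨hrB, hr1, hβ⟩ ⟨⟨hh, hc⟩, hb⟩
      refine ⟨hh, fun x hx => (hb x hx).1, fun x hx => (hb x hx).2.2.1, fun u => ?_⟩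
      exact circleAverage_abs_log_norm_sub_increment_le (by linarith) hK1 hβ hh
        (fun x hx => (hb x hx).2.2.1) (fun x hx => (hb x hx).2.2.2) (hatPt_add_checkPt s)
        (hatPt_mul_checkPt hs) u)
  obtain ⟨C₂, hC₂, h₂⟩ := exists_eventually_meanIncrement_le hf hn a (y := checkPt s)
    (A := 4 * log 2 + 3 * log⁺ K) hK1 (by
      filter_upwards [hev, bound] with r ⟨hrB, hr1, hβ⟩ ⟨⟨hh, hc⟩, hb⟩
      refine ⟨hc, fun x hx => (hb x hx).2.1, fun x hx => (hb x hx).2.2.2, fun u => ?_⟩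
      exact circleAverage_abs_log_norm_sub_increment_le (by linarith) hK1 hβ hc
        (fun x hx => (hb x hx).2.2.2) (fun x hx => (hb x hx).2.2.1)
        (fun x => by rw [add_comm]; exact hatPt_add_checkPt s x)
        (fun x => by rw [mul_comm]; exact hatPt_mul_checkPt hs x) u)
  refine ⟨C₁ + C₂, by positivity, ?_⟩
  filter_upwards [h₁, h₂] with r h1 h2
  linarith

theorem exists_eventually_characteristic_le {s : ℂ} (hs : s ≠ 0) (hs1 : ‖s‖ < 1)
    {f : ℂ → ℂ} (hf : Meromorphic f) (hn : Nonconstant f)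
    (hD : ∀ z, meromorphicOrderAt (awOp s f) z ≠ ⊤) (V : Finset (WithTop ℂ)) (hV3 : 3 ≤ V.card)
    (hV : ∀ v ∈ V, IsAWPicardValue s f v) :
    ∃ C : ℝ, 0 ≤ C ∧ ∀ᶠ r in atTop,
      characteristic f ⊤ r ≤ C * (log r + characteristic f ⊤ (r ^ 4) / log r) := by
  set A : Finset ℂ := V.preimage (↑) WithTop.coe_injective.injOn with hA
  have hAV (a : ℂ) : a ∈ A ↔ (a : WithTop ℂ) ∈ V := Finset.mem_preimage
  have hAne : A.Nonempty := by
    obtain ⟨v, hv, hvt⟩ := Finset.exists_mem_ne (s := V) (by omega) ⊤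
    lift v to ℂ using hvt
    exact ⟨v, (hAV v).2 hv⟩
  set K : ℝ := ‖s‖⁻¹ + 1 with hK
  have hK1 : 1 ≤ K := by
    have : 0 ≤ ‖s‖⁻¹ := by positivity
    linarith
  obtain ⟨C₁, h₁⟩ := exists_eventually_sum_logCounting_le hs hs1 hf hn hD V hV
  obtain ⟨C₂, h₂⟩ := exists_eventually_circleAverage_log_norm_awOp_le hs hs1 hf hn hD V A hAne hAV
  choose C₃ hC₃ h₃ using fun a => exists_eventually_meanIncrement_hatPt_checkPt_le hs hs1 hf hn a
  choose C₄ h₄ using exists_abs_characteristic_sub_le hf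
  have h₅ := exists_eventually_logCounting_top_mul_le (f := f) hK1
  set C₀ := C₂ + |log ‖meromorphicTrailingCoeffAt (awOp s f) 0‖| + ∑ v ∈ V, C₄ v + ∑ a ∈ A, C₃ a
    with hC₀
  have hS0 : 0 ≤ ∑ a ∈ A, C₃ a := Finset.sum_nonneg fun a _ => hC₃ a
  refine ⟨|C₀| + |C₁| + log K + ∑ a ∈ A, C₃ a, by have := log_nonneg hK1; positivity, ?_⟩
  filter_upwards [h₁, h₂, (Finset.eventually_all A).2 fun a _ => h₃ a, h₅,
    eventually_ge_atTop (exp 1)] with r h1 h2 h3 h5 hr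
  have hr1 : 1 ≤ r := le_trans (by simp) hr
  have hL : 1 ≤ log r := by rwa [le_log_iff_exp_le (by linarith)]
  set T := characteristic f ⊤ r with hT
  set T' := characteristic f ⊤ (r ^ 4) with hT'
  have hT0 : 0 ≤ T := ValueDistribution.characteristic_nonneg hr1
  have hT'0 : 0 ≤ T' := ValueDistribution.characteristic_nonneg (one_le_pow₀ hr1)
  have e1 : 3 * T ≤ ∑ v ∈ V, characteristic f v r + ∑ v ∈ V, C₄ v := by
    rw [← Finset.sum_add_distrib]
    calc 3 * T ≤ V.card * T := by gcongr; exact_mod_cast hV3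
      _ = ∑ v ∈ V, T := by simp
      _ ≤ _ := Finset.sum_le_sum fun v _ => by linarith [(abs_le.1 (h₄ v r)).2]
  have e2 : ∑ v ∈ V, characteristic f v r = ∑ v ∈ V, proximity f v r
      + ∑ v ∈ V, ValueDistribution.logCounting f v r := Finset.sum_add_distrib
  have e3 : T = proximity f ⊤ r + ValueDistribution.logCounting f ⊤ r := rfl
  -- Jensen's formula: the mean of `log |D_q f|` in the proximity half cancels the counting function
  -- of its divisor in the counting half.
  have e4 := logCounting_divisor_eq_circleAverage_sub_const (R := r) (meromorphic_awOp hs hf)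
    (by linarith)
  have e5 : ∑ a ∈ A, (meanIncrement f (hatPt s) a r + meanIncrement f (checkPt s) a r) ≤
      (∑ a ∈ A, C₃ a) * ((1 + T') / log r) := by
    rw [Finset.sum_mul]
    exact Finset.sum_le_sum h3
  have e6 : (1 + T') / log r ≤ 1 + T' / log r := by
    rw [add_div]
    gcongr
    exact div_le_one_of_le₀ hL (by linarith)
  have e7 := mul_le_mul_of_nonneg_left e6 hS0
  have e8 := neg_abs_le (log ‖meromorphicTrailingCoeffAt (awOp s f) 0‖)
  -- The halves add up to `3 T ≤ 2 m(r, f) + 2 N(r, f) + error = 2 T + error`.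
  have e9 : T ≤ C₀ + C₁ * log r + (log K + ∑ a ∈ A, C₃ a) * (T' / log r) := by
    linarith
  have hTL : 0 ≤ T' / log r := by positivity
  have b1 : C₀ ≤ |C₀| * log r := (le_abs_self _).trans (le_mul_of_one_le_right (abs_nonneg _) hL)
  have b2 : C₁ * log r ≤ |C₁| * log r := by gcongr; exact le_abs_self _
  have b3 := log_nonneg hK1
  have b4 : 0 ≤ (|C₀| + |C₁|) * (T' / log r) := by positivity
  have b5 : 0 ≤ (log K + ∑ a ∈ A, C₃ a) * log r := by positivity
  linarith

end AskeyWilson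

namespace AskeyWilson

open Real Metric MeromorphicOn Bornology Function.locallyFinsuppWithin
open ValueDistribution (characteristic proximity)

/-! ### Finite logarithmic order -/

theorem exists_eventually_le_log_pow {T : ℝ → ℝ} (h0 : ∀ r, 1 ≤ r → 0 ≤ T r)
    (h : limsup (fun r : ℝ => ((log (T r) / log (log r) : ℝ) : EReal)) atTop < ⊤) :
    ∃ p : ℕ, ∀ᶠ r in atTop, T r ≤ log r ^ p := by
  obtain ⟨M, hM1, hM⟩ := EReal.lt_iff_exists_real_btwn.1 h
  have h1 := eventually_lt_of_limsup_lt hM1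
  obtain ⟨p, hp⟩ := exists_nat_ge M
  refine ⟨p, ?_⟩
  have h2 : Tendsto (fun r => log (log r)) atTop atTop := tendsto_log_atTop.comp tendsto_log_atTop
  filter_upwards [h1, h2.eventually_gt_atTop 0, tendsto_log_atTop.eventually_gt_atTop 0,
    eventually_ge_atTop 1] with r h1 h2 h3 hr
  -- The case `T r = 0` is separate, since there `log (T r)` is `0` by convention and carries no
  -- information.
  rcases (h0 r hr).eq_or_lt with hT | hT
  · rw [← hT]; positivity
  · rw [EReal.coe_lt_coe_iff, div_lt_iff₀ h2] at h1
    rw [← log_le_log_iff hT (by positivity), log_pow]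
    nlinarith

/-- Replacing `r` by `r ^ 4` multiplies `log r` by `4` only, so dividing by `log r` lowers the
exponent by one at the price of a constant. The descent stops at exponent one because of the term
`log r`. -/
theorem exists_eventually_le_mul_log {T : ℝ → ℝ} {C : ℝ} (hC : 0 ≤ C)
    (h : ∀ᶠ r in atTop, T r ≤ C * (log r + T (r ^ 4) / log r)) {p : ℕ} {B : ℝ}
    (hp : ∀ᶠ r in atTop, T r ≤ B * log r ^ (p + 1)) :
    ∃ B : ℝ, ∀ᶠ r in atTop, T r ≤ B * log r := by
  induction p generalizing B with
  | zero => exact ⟨B, by simpa using hp⟩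
  | succ p ih =>
    refine ih (B := C * (1 + 4 ^ (p + 2) * |B|)) ?_
    have h4 : Tendsto (fun r : ℝ => r ^ 4) atTop atTop := tendsto_pow_atTop (by norm_num)
    filter_upwards [h, h4.eventually hp, tendsto_log_atTop.eventually_ge_atTop 1] with r h1 h2 hL
    rw [log_pow] at h2
    refine h1.trans ?_
    rw [mul_assoc]
    refine mul_le_mul_of_nonneg_left ?_ hC
    have h3 : T (r ^ 4) / log r ≤ 4 ^ (p + 2) * |B| * log r ^ (p + 1) := by
      rw [div_le_iff₀ (by linarith)]
      refine h2.trans ?_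
      push_cast
      have : B * (4 * log r) ^ (p + 1 + 1) ≤ |B| * (4 * log r) ^ (p + 1 + 1) := by
        gcongr
        exact le_abs_self B
      refine this.trans (le_of_eq ?_)
      ring
    have h5 : log r ≤ log r ^ (p + 1) := le_self_pow₀ hL (by omega)
    linarith

/-! ### Slowly growing meromorphic functions are rational -/

theorem finite_support_divisor_of_characteristic_le {f : ℂ → ℂ} (hf : Meromorphic f) {B : ℝ}
    (h : ∀ᶠ r in atTop, characteristic f ⊤ r ≤ B * log r) :
    (divisor f Set.univ).support.Finite := by
  have key (v : WithTop ℂ) : (valueDivisor f v).support.Finite := by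
    obtain ⟨c, hc⟩ := exists_abs_characteristic_sub_le hf v
    have hO : logCounting (valueDivisor f v) =O[atTop] log := by
      refine Asymptotics.IsBigO.of_bound (|B| + |c|) ?_
      filter_upwards [h, tendsto_log_atTop.eventually_ge_atTop 1, eventually_ge_atTop 1]
        with r h1 hL hr
      have h2 := (abs_le.1 (hc r)).1
      have h3 : ValueDistribution.logCounting f v r ≤ characteristic f v r :=
        le_add_of_nonneg_left (ValueDistribution.proximity_nonneg _)
      have h4 : 0 ≤ ValueDistribution.logCounting f v r := ValueDistribution.logCounting_nonneg hr
      rw [← logCounting_eq_logCounting_valueDivisor, Real.norm_of_nonneg h4,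
        Real.norm_of_nonneg (by linarith)]
      have h5 : B * log r ≤ |B| * log r := by gcongr; exact le_abs_self B
      have h6 : c ≤ |c| * log r := (le_abs_self c).trans (le_mul_of_one_le_right (abs_nonneg c) hL)
      linarith
    exact finite_support_of_logCounting_isBigO_log (valueDivisor_nonneg f v) hO
  have h1 := key ((0 : ℂ) : WithTop ℂ)
  have h2 := key ⊤
  refine (h1.union h2).subset fun x hx => ?_
  by_contra hne
  rw [Set.mem_union, not_or, Function.mem_support, Function.mem_support, not_not, not_not] at hne
  apply hx
  simp only [valueDivisor, sub_zero] at hne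
  have := congrArg (fun D => D x) (posPart_sub_negPart (divisor f Set.univ))
  rw [← this, Function.locallyFinsuppWithin.coe_sub, Pi.sub_apply, hne.1, hne.2, sub_zero]

theorem zpow_eq_pow_toNat_div (z : ℂ) (n : ℤ) : z ^ n = z ^ n.toNat / z ^ (-n).toNat := by
  rcases Int.eq_nat_or_neg n with ⟨m, rfl | rfl⟩ <;> simp

theorem isRational_of_eventuallyEq_prod {f : ℂ → ℂ} {F : Finset ℂ} {D : ℂ → ℤ} {c : ℂ}
    (h : f =ᶠ[codiscrete ℂ] fun z => (∏ u ∈ F, (z - u) ^ D u) * c) : IsRational f := by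
  refine ⟨(∏ u ∈ F, (Polynomial.X - Polynomial.C u) ^ (D u).toNat) * Polynomial.C c,
    ∏ u ∈ F, (Polynomial.X - Polynomial.C u) ^ (-D u).toNat,
    Finset.prod_ne_zero_iff.2 fun u _ => pow_ne_zero _ (Polynomial.X_sub_C_ne_zero u),
    h.trans (Eventually.of_forall fun z => ?_)⟩
  simp only [Polynomial.eval_mul, Polynomial.eval_prod, Polynomial.eval_pow, Polynomial.eval_sub,
    Polynomial.eval_X, Polynomial.eval_C, zpow_eq_pow_toNat_div (z - _), Finset.prod_div_distrib]
  ring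

/-- The increment of the harmonic function `log ‖g‖` between `x` and `0` is `O(log R / R)`, hence
zero. So `‖g‖` is constant, and Liouville's theorem applies. -/
theorem eq_const_of_circleAverage_le {g : ℂ → ℂ} (hg : AnalyticOnNhd ℂ g Set.univ)
    (hg0 : ∀ z, g z ≠ 0) {C : ℝ}
    (h : ∀ᶠ R in atTop, circleAverage (fun z => |log ‖g z‖|) 0 R ≤ C * log R) (z : ℂ) :
    g z = g 0 := by
  have hlog (x : ℂ) : log ‖g x‖ = log ‖g 0‖ := by
    have hlim : Tendsto (fun R => 8 * ‖x - 0‖ * C * (log R / R)) atTop (𝓝 0) := by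
      have := (isLittleO_log_id_atTop.tendsto_div_nhds_zero).const_mul (8 * ‖x - 0‖ * C)
      simpa using this
    rw [← sub_eq_zero, ← abs_nonpos_iff]
    refine ge_of_tendsto hlim ?_
    filter_upwards [h, eventually_gt_atTop 0, eventually_ge_atTop (2 * ‖x‖)] with R h1 h2 h3
    have hu : InnerProductSpace.HarmonicOnNhd (fun z => log ‖g z‖) (closedBall 0 R) :=
      fun z _ => (hg z trivial).harmonicAt_log_norm (hg0 z)
    refine (abs_sub_le_of_harmonicOnNhd h2 hu (by linarith) (by simp; linarith)).trans ?_
    calc 8 * ‖x - 0‖ / R * circleAverage (fun z => |log ‖g z‖|) 0 R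
        ≤ 8 * ‖x - 0‖ / R * (C * log R) := by gcongr
      _ = _ := by ring
  have hd : Differentiable ℂ g := fun z => (hg z trivial).differentiableAt
  refine hd.apply_eq_apply_of_bounded ?_ z 0
  refine isBounded_iff_forall_norm_le.2 ⟨‖g 0‖, ?_⟩
  rintro _ ⟨x, rfl⟩
  exact (log_injOn_pos (norm_pos_iff.2 (hg0 x)) (norm_pos_iff.2 (hg0 0)) (hlog x)).le

/-- Logarithmic growth leaves only finitely many zeros and poles. After they are divided out
globally, the entire zero-free cofactor still has mean log-modulus `O(log R)`, so it is constant. -/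
theorem isRational_of_characteristic_le {f : ℂ → ℂ} (hf : Meromorphic f)
    (h0 : ∀ z, meromorphicOrderAt f z ≠ ⊤) {B : ℝ}
    (h : ∀ᶠ r in atTop, characteristic f ⊤ r ≤ B * log r) : IsRational f := by
  have hfin := finite_support_divisor_of_characteristic_le hf h
  obtain ⟨g, hg, hg0, hfg, hlog⟩ := exists_eq_prod_mul_and_log_norm_eq (U := Set.univ)
    hf.meromorphicOn (fun z _ => h0 z) hfin
  obtain ⟨c, hc⟩ := exists_abs_characteristic_sub_le hf ((0 : ℂ) : WithTop ℂ)
  set F := hfin.toFinset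
  obtain ⟨M, hM⟩ : ∃ M, ∀ u ∈ F, ‖u‖ ≤ M :=
    ⟨∑ u ∈ F, ‖u‖, fun u hu => Finset.single_le_sum (f := fun u : ℂ => ‖u‖) (fun _ _ => norm_nonneg _) hu⟩
  set n := ∑ u ∈ F, |(divisor f Set.univ u : ℝ)|
  have hgc := eq_const_of_circleAverage_le (C := 2 * |B| + |c| + n * 4) hg
    (fun z => hg0 z trivial) (by
    filter_upwards [h, eventually_ge_atTop (exp 1), eventually_ge_atTop 2, eventually_ge_atTop M]
      with R h1 h2 h3 h4
    have hL : 1 ≤ log R := by rwa [le_log_iff_exp_le (by linarith)]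
    have hF : ∀ u ∈ F, ‖u‖ ≤ R := fun u hu => (hM u hu).trans h4
    have b1 := circleAverage_abs_log_norm_le_of_factor (R := R) (by linarith) hf
      (D := divisor f Set.univ) hF (hg.mono (Set.subset_univ _))
      (hlog.filter_mono (codiscreteWithin_mono (Set.subset_univ _)))
    rw [circleAverage_abs_log_norm_eq hf] at b1
    have b2 := (abs_le.1 (hc R)).1
    have b3 : proximity f ⊤ R ≤ characteristic f ⊤ R :=
      le_add_of_nonneg_right (ValueDistribution.logCounting_nonneg (by linarith))
    have b4 : proximity f⁻¹ ⊤ R ≤ characteristic f ((0 : ℂ) : WithTop ℂ) R := by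
      rw [ValueDistribution.proximity_inv]
      exact le_add_of_nonneg_right (ValueDistribution.logCounting_nonneg (by linarith))
    have b5 : log (2 * R) ≤ 2 * log R := by
      rw [log_mul two_ne_zero (by positivity)]
      linarith [log_le_log two_pos h3]
    have b6 : n * (2 * log (2 * R)) ≤ n * 4 * log R := by
      have hn : 0 ≤ n := Finset.sum_nonneg fun _ _ => abs_nonneg _
      calc n * (2 * log (2 * R)) ≤ n * (2 * (2 * log R)) := by gcongr
        _ = _ := by ring
    have b7 : B * log R ≤ |B| * log R := by gcongr; exact le_abs_self B
    have b8 : c ≤ |c| * log R := (le_abs_self c).trans (le_mul_of_one_le_right (abs_nonneg c) hL)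
    linarith)
  refine isRational_of_eventuallyEq_prod (F := F) (D := divisor f Set.univ) (c := g 0) ?_
  filter_upwards [hfg] with z hz
  rw [hz, hgc z]

theorem isRational_or_nonconstant {f : ℂ → ℂ} (hf : Meromorphic f) :
    IsRational f ∨ Nonconstant f := by
  by_cases hn : Nonconstant f
  · exact Or.inr hn
  left
  unfold Nonconstant at hn
  push Not at hn
  obtain ⟨a, z, hz⟩ := hn
  rcases order_ne_top_or_eventuallyEq_zero (meromorphic_sub_const hf a) with h | h
  · exact absurd hz (h z)
  · refine ⟨Polynomial.C a, 1, one_ne_zero, ?_⟩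
    filter_upwards [h] with x hx
    simpa [sub_eq_zero] using hx

end AskeyWilson

/-! ### The main theorem -/

theorem theoremT (q s : ℂ) (hq0 : q ≠ 0) (hq1 : ‖q‖ < 1) (hs : s ^ 2 = q)
    (f : ℂ → ℂ) (hf : Meromorphic f)
    (hord : AskeyWilson.logarithmicOrder f < ⊤)
    (a b c : WithTop ℂ) (hab : a ≠ b) (hac : a ≠ c) (hbc : b ≠ c)
    (ha : AskeyWilson.IsAWPicardValue s f a)
    (hb : AskeyWilson.IsAWPicardValue s f b)
    (hc : AskeyWilson.IsAWPicardValue s f c) :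
    AskeyWilson.IsRational f ∨ AskeyWilson.InKerAW s f := by
  classical
  have hs0 : s ≠ 0 := by
    rintro rfl
    exact hq0 (by rw [← hs]; simp)
  have hs1 : ‖s‖ < 1 := by
    rw [← hs, norm_pow] at hq1
    exact (pow_lt_one_iff_of_nonneg (norm_nonneg s) two_ne_zero).1 hq1
  rcases AskeyWilson.isRational_or_nonconstant hf with h | hn
  · exact Or.inl h
  rcases AskeyWilson.order_ne_top_or_eventuallyEq_zero (AskeyWilson.meromorphic_awOp hs0 hf)
    with hD | hD
  · left
    obtain ⟨C, hC, hT⟩ := AskeyWilson.exists_eventually_characteristic_le hs0 hs1 hf hn hD {a, b, c}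
      (by rw [Finset.card_eq_three.2 ⟨a, b, c, hab, hac, hbc, rfl⟩]) (by simp [ha, hb, hc])
    obtain ⟨p, hp⟩ := AskeyWilson.exists_eventually_le_log_pow
      (fun r hr => ValueDistribution.characteristic_nonneg hr) hord
    obtain ⟨B, hB⟩ := AskeyWilson.exists_eventually_le_mul_log hC hT (p := p) (B := 1) (by
      filter_upwards [hp, Real.tendsto_log_atTop.eventually_ge_atTop 1] with r h1 h2
      rw [one_mul]
      exact h1.trans (pow_le_pow_right₀ h2 p.le_succ))
    exact AskeyWilson.isRational_of_characteristic_le hf hn.order_ne_top hB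
  · exact Or.inr hD
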